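/- Let $n\ge 1$ and let $F:\mathbb R\to\mathbb R$ be admissible on $\mathbb R$, that is, strictly increasing and continuous. Let $f_F$ be the inverse function of $F$ on $J_F:=F(\mathbb R)$. For a function $\phi:\mathbb R^n\to\mathbb R$ bounded from below, set $$[e^{t\Delta}\phi](x):=\int_{\mathbb R^n}(4\pi t)^{-n/2}\exp\Bigl(-\frac{|x-y|^2}{4t}\Bigr)\phi(y)\,\mathrm dy\quad(t>0),$$ and let $T(\phi)\in[0,\infty]$ be the maximal existence time of $e^{t\Delta}\phi$, i.e. the largest $T$ such that this integral converges absolutely for all $t\in(0,T)$ and $x\in\mathbb R^n$. A function $\phi:\mathbb R^n\to\mathbb R$ is called $F$-convex if $F(\phi)$ is convex on $\mathbb R^n$. We say that $F$-convexity is preserved under the heat flow if, for every $F$-convex function $\phi$ on $\mathbb R^n$ that is bounded from below and satisfies $T(\phi)>0$, the function $e^{t\Delta}\phi$ is $F$-convex for all $t\in(0,T(\phi))$. We say that $F$-convexity is only trivially preserved under the heat flow if every $F$-convex function $\phi$ on $\mathbb R^n$ that is bounded from below, satisfies $T(\phi)>0$, and is such that $e^{t\Delta}\phi$ is $F$-convex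 for all $t\in(0,T(\phi))$, is constant. Then the following hold. (1) If $\lim_{r\to\infty}F(r)<\infty$, then $F$-convexity is only trivially preserved under the heat flow. (2) If $\lim_{r\to\infty}F(r)=\infty$ and $$\int_{F(1)}^\infty e^{-Az^2}f_F(z)\,\mathrm dz=\infty\quad\text{for any }A>0,$$ then $F$-convexity is only trivially preserved under the heat flow. (3) Let $F\in C^2(\mathbb R)$ and $\lim_{r\to\infty}F(r)=\infty$, and assume that $$\int_{F(1)}^\infty e^{-Az^2}f_F(z)\,\mathrm dz<\infty\quad\text{for some }A>0.$$ Then $F$-convexity is preserved under the heat flow if and only if $F'>0$ on $\mathbb R$ and $g_F:=(\log f_F')'$ is convex on $J_F$. -/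

import Mathlib

open Set Filter Topology MeasureTheory
open scoped ENNReal

noncomputable section

namespace HeatFConvex

/-- Euclidean space `ℝⁿ`. -/
abbrev E (n : ℕ) : Type := EuclideanSpace ℝ (Fin n)

/-- The Gauss kernel `Γ_n(x,t) = (4πt)^{-n/2} exp(-|x|²/(4t))`, for `t > 0`. -/
def gaussKernel (n : ℕ) (x : E n) (t : ℝ) : ℝ :=
  (4 * Real.pi * t) ^ (-(n : ℝ) / 2) * Real.exp (-‖x‖ ^ 2 / (4 * t))

/-- The heat flow `[e^{tΔ}φ](x)`, for `t ≥ 0`; it is `φ` itself at `t = 0`. -/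
def heatFlow {n : ℕ} (φ : E n → ℝ) (t : ℝ) (x : E n) : ℝ :=
  if t = 0 then φ x else ∫ y, gaussKernel n (x - y) t * φ y

/-- The maximal existence time `T(φ) ∈ [0,∞]` of `e^{tΔ}φ`: the largest `T` such that the
integral defining `[e^{tΔ}φ](x)` converges for all `t ∈ (0,T)` and all `x`. -/
def existenceTime {n : ℕ} (φ : E n → ℝ) : ℝ≥0∞ :=
  sSup {T : ℝ≥0∞ | ∀ t : ℝ, 0 < t → ENNReal.ofReal t < T →
    ∀ x : E n, Integrable (fun y => gaussKernel n (x - y) t * φ y)}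

/-- Admissible functions on `ℝ`. -/
structure Admissible (F : ℝ → ℝ) : Prop where
  strictMono : StrictMono F
  continuous : Continuous F

/-- `J_F = F(ℝ)`. -/
def imageSet (F : ℝ → ℝ) : Set ℝ := range F

/-- `f_F`, the inverse function of `F`; only its values on `J_F` are meaningful. -/
def inverse (F : ℝ → ℝ) : ℝ → ℝ := Function.invFun F

/-- `g_F = (log f_F')'`. -/
def logDerivInverse (F : ℝ → ℝ) : ℝ → ℝ :=
  deriv (fun z => Real.log (deriv (inverse F) z))

/-- `φ` is `F`-convex: `F(φ)` is convex on `ℝⁿ`. -/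
def FConvex {n : ℕ} (F : ℝ → ℝ) (φ : E n → ℝ) : Prop :=
  ConvexOn ℝ univ (fun x => F (φ x))

/-- `φ` is bounded from below on `ℝⁿ`. -/
def BoundedBelow {n : ℕ} (φ : E n → ℝ) : Prop := BddBelow (range φ)

/-- `F`-convexity is preserved under the heat flow on `ℝⁿ` (initial data bounded from below). -/
def Preserved (n : ℕ) (F : ℝ → ℝ) : Prop :=
  ∀ φ : E n → ℝ, BoundedBelow φ → FConvex F φ → 0 < existenceTime φ →
    ∀ t : ℝ, 0 < t → ENNReal.ofReal t < existenceTime φ → FConvex F (heatFlow φ t)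

/-- `F`-convexity is only trivially preserved under the heat flow on `ℝⁿ`
(initial data bounded from below). -/
def OnlyTriviallyPreserved (n : ℕ) (F : ℝ → ℝ) : Prop :=
  ∀ φ : E n → ℝ, BoundedBelow φ → FConvex F φ → 0 < existenceTime φ →
    (∀ t : ℝ, 0 < t → ENNReal.ofReal t < existenceTime φ → FConvex F (heatFlow φ t)) →
    ∃ c : ℝ, ∀ x, φ x = c

/-- `∫_{F(1)}^∞ e^{-A z²} f_F(z) dz ∈ [0,∞]`. When `F(r) → ∞` as `r → ∞`, the interval
`[F(1),∞)` lies in `J_F` and `f_F ≥ 1` on it, so the integrand is positive. -/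
def gaussIntegral (F : ℝ → ℝ) (A : ℝ) : ℝ≥0∞ :=
  ∫⁻ z in Ici (F 1), ENNReal.ofReal (Real.exp (-A * z ^ 2) * inverse F z)

end HeatFConvex

end

open Set Filter Topology MeasureTheory ProbabilityTheory
open scoped ENNReal NNReal

noncomputable section

namespace HeatFConvex

/-! Triviality. If `F` is bounded above, `F ∘ φ` is a convex function bounded above, hence constant.
If `F → ∞` and `φ` is nonconstant on some line, convexity makes `F ∘ φ` grow at least linearly in
one direction of it, so `φ` dominates `f_F` of an affine function there. Gaussian integrability of
`φ` along that line would then make `∫ e^{-Az²} f_F` finite for some `A`. By Fubini almost every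
line parallel to an axis has this integrability, so `φ` is constant on it, and by continuity on all
such lines.

Sufficiency. If `u` solves the one-dimensional heat equation, `v = F(u)` solves `v_t = v_yy + g_F(v)
v_y²`. Three such solutions with `vm(l y0 + m y1) ≤ l v0(y0) + m v1(y1)` at time zero keep this
inequality. At a positive maximum of the difference the three slopes agree, the second derivative
along `(1, 1)` has the good sign, and convexity of `g_F` bounds the remaining term by a multiple of
the difference, which an exponential factor absorbs (`three_function_maximum_principle`). As for the
Prékopa–Leindler inequality, the three-function form is stable under integrating out one coordinate,
so induction gives every dimension (`gaussian_three_function`). Lipschitz truncations from below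
remove boundedness (`integral_three_function`), and translates of one `φ` give the claim.

Necessity. The datum `f_F(max(x_i, F a))` is `F`-convex. Its flow `u` satisfies `F(u) = s` at time
zero for `s = x_i > F a`, and the time derivative of `F(u)` there is `g_F(s)` where `F' > 0`.
Convexity of `F(u)` at small times therefore passes to `g_F` (`Preserved.convexOn_logDerivInverse`).
A zero of `F'` is excluded because convexity of `g_F` to the right of it would keep `log f_F'`
bounded above there (`Admissible.deriv_ne_zero_of_convexOn`). -/

/-! ### The heat flow as a Gaussian average -/

/-- The density of a finite product of measures with real densities. -/
theorem pi_withDensity_ofReal {ι : Type*} [Fintype ι] (μ : Measure ℝ) [SigmaFinite μ]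
    (p : ℝ → ℝ) (hp : Integrable p μ) (hp0 : ∀ x, 0 ≤ p x) :
    Measure.pi (fun _ : ι => μ.withDensity fun x => ENNReal.ofReal (p x)) =
      (Measure.pi fun _ : ι => μ).withDensity fun x => ENNReal.ofReal (∏ i, p (x i)) := by
  have : IsFiniteMeasure (μ.withDensity fun x => ENNReal.ofReal (p x)) :=
    isFiniteMeasure_withDensity_ofReal hp.2
  refine Measure.pi_eq fun s hs => ?_
  rw [withDensity_apply _ (MeasurableSet.univ_pi hs), Measure.restrict_pi_pi,
    ← ofReal_integral_eq_lintegral_ofReal (Integrable.fintype_prod fun i => hp.restrict)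
      (ae_of_all _ fun x => Finset.prod_nonneg fun i _ => hp0 _),
    integral_fintype_prod_eq_prod (fun (_ : ι) => p),
    ENNReal.ofReal_prod_of_nonneg fun i _ => integral_nonneg hp0]
  refine Finset.prod_congr rfl fun i _ => ?_
  rw [withDensity_apply _ (hs i),
    ofReal_integral_eq_lintegral_ofReal hp.restrict (ae_of_all _ hp0)]

/-- The centred Gaussian measure on `ℝ` whose density is the one-dimensional heat kernel at
time `t`. -/
def heatMeasure (t : ℝ) : Measure ℝ := gaussianReal 0 (2 * t).toNNReal

instance (t : ℝ) : IsProbabilityMeasure (heatMeasure t) := by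
  unfold heatMeasure; infer_instance

/-- The product of `n` copies of `heatMeasure t`. -/
def heatMeasurePi (n : ℕ) (t : ℝ) : Measure (Fin n → ℝ) := Measure.pi fun _ => heatMeasure t

instance (n : ℕ) (t : ℝ) : IsProbabilityMeasure (heatMeasurePi n t) := by
  unfold heatMeasurePi; infer_instance

theorem toNNReal_two_mul_ne_zero {t : ℝ} (ht : 0 < t) : (2 * t).toNNReal ≠ 0 := by
  have : 0 < (2 * t).toNNReal := Real.toNNReal_pos.2 (by linarith)
  exact this.ne'

theorem gaussKernel_toLp {n : ℕ} {t : ℝ} (ht : 0 < t) (z : Fin n → ℝ) :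
    gaussKernel n (WithLp.toLp 2 z) t = ∏ i, gaussianPDFReal 0 (2 * t).toNNReal (z i) := by
  have h2 : (((2 * t).toNNReal : ℝ≥0) : ℝ) = 2 * t := Real.coe_toNNReal _ (by linarith)
  simp only [gaussKernel, gaussianPDFReal, h2, Finset.prod_mul_distrib, Finset.prod_const,
    Finset.card_univ, Fintype.card_fin, sub_zero]
  congr 1
  · have hpos : 0 < 4 * Real.pi * t := by positivity
    rw [show 2 * Real.pi * (2 * t) = 4 * Real.pi * t by ring, inv_pow, Real.sqrt_eq_rpow,
      ← Real.rpow_natCast, ← Real.rpow_mul hpos.le, neg_div, Real.rpow_neg hpos.le]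
    ring_nf
  · rw [← Real.exp_sum, EuclideanSpace.norm_sq_eq]
    congr 1
    simp only [Real.norm_eq_abs, sq_abs, neg_div, Finset.sum_neg_distrib, Finset.sum_div]
    exact congrArg Neg.neg (Finset.sum_congr rfl fun i _ => by ring)

theorem heatMeasurePi_eq_withDensity {n : ℕ} {t : ℝ} (ht : 0 < t) :
    heatMeasurePi n t = (volume : Measure (Fin n → ℝ)).withDensity
      fun z => ENNReal.ofReal (gaussKernel n (WithLp.toLp 2 z) t) := by
  simp_rw [gaussKernel_toLp ht]
  unfold heatMeasurePi heatMeasure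
  rw [gaussianReal_of_var_ne_zero _ (toNNReal_two_mul_ne_zero ht)]
  exact pi_withDensity_ofReal volume _ (integrable_gaussianPDFReal _ _) (gaussianPDFReal_nonneg _ _)

theorem gaussKernel_nonneg {n : ℕ} {t : ℝ} (ht : 0 < t) (x : E n) : 0 ≤ gaussKernel n x t := by
  unfold gaussKernel; positivity

theorem measurable_gaussKernel_toLp (n : ℕ) (t : ℝ) :
    Measurable fun z : Fin n → ℝ => ENNReal.ofReal (gaussKernel n (WithLp.toLp 2 z) t) := by
  unfold gaussKernel
  have : Measurable fun z : Fin n → ℝ => (WithLp.toLp 2 z : E n) :=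
    (PiLp.continuous_toLp 2 _).measurable
  fun_prop

theorem gaussKernel_neg {n : ℕ} (t : ℝ) (x : E n) : gaussKernel n (-x) t = gaussKernel n x t := by
  simp [gaussKernel]

/-- Substitute `y = x + z` and use that the kernel is even. The integral becomes one against a fixed
product measure, which is what makes Fubini available. -/
theorem integrable_gaussKernel_iff {n : ℕ} {t : ℝ} (ht : 0 < t) (φ : E n → ℝ) (x : E n) :
    Integrable (fun y => gaussKernel n (x - y) t * φ y) ↔
      Integrable (fun z => φ (x + WithLp.toLp 2 z)) (heatMeasurePi n t) := by
  rw [heatMeasurePi_eq_withDensity ht, integrable_withDensity_iff_integrable_smul'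
    (measurable_gaussKernel_toLp n t) (ae_of_all _ fun _ => ENNReal.ofReal_lt_top),
    ← (measurePreserving_add_left (volume : Measure (E n)) x).integrable_comp_emb
      (MeasurableEquiv.addLeft x).measurableEmbedding,
    ← (PiLp.volume_preserving_toLp (Fin n)).integrable_comp_emb
      (MeasurableEquiv.toLp 2 (Fin n → ℝ)).measurableEmbedding]
  refine integrable_congr (ae_of_all _ fun z => ?_)
  simp [Function.comp_def, ENNReal.toReal_ofReal (gaussKernel_nonneg ht _), gaussKernel_neg]

theorem heatFlow_eq_integral {n : ℕ} {t : ℝ} (ht : 0 < t) (φ : E n → ℝ) (x : E n) :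
    heatFlow φ t x = ∫ z, φ (x + WithLp.toLp 2 z) ∂(heatMeasurePi n t) := by
  rw [heatFlow, if_neg ht.ne', heatMeasurePi_eq_withDensity ht,
    integral_withDensity_eq_integral_toReal_smul
    (measurable_gaussKernel_toLp n t) (ae_of_all _ fun _ => ENNReal.ofReal_lt_top),
    ← (measurePreserving_add_left (volume : Measure (E n)) x).integral_comp
      (MeasurableEquiv.addLeft x).measurableEmbedding,
    ← (PiLp.volume_preserving_toLp (Fin n)).integral_comp
      (MeasurableEquiv.toLp 2 (Fin n → ℝ)).measurableEmbedding]
  refine integral_congr_ae (ae_of_all _ fun z => ?_)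
  simp [ENNReal.toReal_ofReal (gaussKernel_nonneg ht _), gaussKernel_neg]

theorem integrable_of_lt_existenceTime {n : ℕ} {φ : E n → ℝ} {t : ℝ} (ht : 0 < t)
    (h : ENNReal.ofReal t < existenceTime φ) (x : E n) :
    Integrable (fun z => φ (x + WithLp.toLp 2 z)) (heatMeasurePi n t) := by
  obtain ⟨T, hT, htT⟩ := lt_sSup_iff.1 h
  exact (integrable_gaussKernel_iff ht φ x).1 (hT t ht htT x)

theorem exists_pos_lt_of_pos {T : ℝ≥0∞} (h : 0 < T) : ∃ t : ℝ, 0 < t ∧ ENNReal.ofReal t < T := by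
  obtain ⟨s, hs0, hsT⟩ := ENNReal.lt_iff_exists_nnreal_btwn.1 h
  exact ⟨s, by exact_mod_cast hs0, by simpa using hsT⟩

/-! ### The one-dimensional heat flow -/

/-- The one-dimensional heat flow of `φ`. -/
def lineFlow (φ : ℝ → ℝ) (t y : ℝ) : ℝ := ∫ z, φ (y + z) ∂(heatMeasure t)

theorem heatMeasure_eq_map {t : ℝ} (ht : 0 ≤ t) :
    heatMeasure t = (gaussianReal 0 1).map (Real.sqrt (2 * t) * ·) := by
  rw [gaussianReal_map_const_mul, heatMeasure]
  congr 1
  · simp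
  · ext
    have h2 : (0 : ℝ) ≤ 2 * t := by linarith
    rw [Real.coe_toNNReal _ h2, mul_one]
    exact (Real.sq_sqrt h2).symm

/-- Rescaling moves the time dependence from the measure into the integrand. The formula includes `t
= 0`, so continuity and asymptotics at time zero follow by dominated convergence. -/
theorem lineFlow_eq_integral_sqrt {φ : ℝ → ℝ} (hφ : Measurable φ) {t : ℝ} (ht : 0 ≤ t) (y : ℝ) :
    lineFlow φ t y = ∫ z, φ (y + Real.sqrt (2 * t) * z) ∂(gaussianReal 0 1) := by
  rw [lineFlow, heatMeasure_eq_map ht, integral_map (by fun_prop)]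
  exact (hφ.comp (measurable_const_add y)).aestronglyMeasurable

theorem lineFlow_zero {φ : ℝ → ℝ} (hφ : Measurable φ) (y : ℝ) : lineFlow φ 0 y = φ y := by
  simp [lineFlow_eq_integral_sqrt hφ le_rfl]

theorem continuousOn_lineFlow {φ : ℝ → ℝ} (hφ : Continuous φ) {B : ℝ} (hB : ∀ x, |φ x| ≤ B) :
    ContinuousOn (fun p : ℝ × ℝ => lineFlow φ p.1 p.2) {p | 0 ≤ p.1} := by
  have h : Continuous fun p : ℝ × ℝ =>
      ∫ z, φ (p.2 + Real.sqrt (2 * p.1) * z) ∂(gaussianReal 0 1) :=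
    continuous_of_dominated (bound := fun _ => B)
      (fun p => (hφ.comp (by fun_prop)).aestronglyMeasurable)
      (fun p => ae_of_all _ fun z => hB _) (integrable_const _)
      (ae_of_all _ fun z => hφ.comp (by fun_prop))
  exact h.continuousOn.congr fun p hp => lineFlow_eq_integral_sqrt hφ.measurable hp _

theorem integrable_comp_add_of_bdd {φ : ℝ → ℝ} (hφ : Measurable φ) {B : ℝ} (hB : ∀ x, |φ x| ≤ B)
    (μ : Measure ℝ) [IsFiniteMeasure μ] (y : ℝ) : Integrable (fun z => φ (y + z)) μ :=
  Integrable.of_bound (hφ.comp (measurable_const_add y)).aestronglyMeasurable B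
    (ae_of_all _ fun _ => hB _)

theorem integral_mem_Icc {Ω : Type*} [MeasurableSpace Ω] {μ : Measure Ω} [IsProbabilityMeasure μ]
    {h : Ω → ℝ} (hi : Integrable h μ) {a b : ℝ} (hab : ∀ x, h x ∈ Icc a b) :
    ∫ x, h x ∂μ ∈ Icc a b := by
  constructor
  · simpa using integral_mono (integrable_const a) hi fun x => (hab x).1
  · simpa using integral_mono hi (integrable_const b) fun x => (hab x).2

/-! ### Differentiating Gaussian integrals in space and time. -/

theorem integrable_one_add_abs_pow_mul_exp (k : ℕ) {c : ℝ} (hc : 0 < c) :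
    Integrable fun x : ℝ => (1 + |x|) ^ k * Real.exp (-c * x ^ 2) := by
  have h0 : Integrable fun x : ℝ => Real.exp (-c * x ^ 2) := integrable_exp_neg_mul_sq hc
  have hk : Integrable fun x : ℝ => |x| ^ k * Real.exp (-c * x ^ 2) := by
    have := (integrable_rpow_mul_exp_neg_mul_sq hc
      (s := (k : ℝ)) (by have : (0:ℝ) ≤ k := k.cast_nonneg
                         linarith)).norm
    refine this.congr (ae_of_all _ fun x => ?_)
    simp [Real.rpow_natCast]
  refine ((h0.add hk).const_mul (2 ^ (k - 1))).mono' (by fun_prop) (ae_of_all _ fun x => ?_)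
  rw [Real.norm_of_nonneg (by positivity)]
  have := add_pow_le zero_le_one (abs_nonneg x) k
  calc (1 + |x|) ^ k * Real.exp (-c * x ^ 2)
      ≤ (2 ^ (k - 1) * (1 ^ k + |x| ^ k)) * Real.exp (-c * x ^ 2) := by gcongr
    _ = _ := by simp; ring

/-- The Gaussian moments `∫ (z - y)^k e^{-(z-y)²/(4t)} φ(z) dz`. -/
def heatMoment (φ : ℝ → ℝ) (k : ℕ) (t y : ℝ) : ℝ :=
  ∫ z, ((z - y) ^ k * Real.exp (-(1 / (4 * t)) * (z - y) ^ 2)) * φ z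

/-- A majorant uniform in the shift `h`, for differentiation under the integral. From `x² ≤ 2(x -
h)² + 2` the Gaussian survives at half the rate. -/
theorem abs_shift_pow_mul_exp_le (k : ℕ) {t : ℝ} (ht : 0 < t) {h : ℝ} (hh : |h| ≤ 1) (x : ℝ) :
    |(x - h) ^ k * Real.exp (-(1 / (4 * t)) * (x - h) ^ 2)| ≤
      2 ^ k * Real.exp (1 / (4 * t)) * ((1 + |x|) ^ k * Real.exp (-(1 / (8 * t)) * x ^ 2)) := by
  rw [abs_mul, abs_pow, Real.abs_exp]
  have h1 : |x - h| ≤ 2 * (1 + |x|) := by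
    have := abs_sub x h
    have := abs_nonneg x
    linarith
  have h2 : Real.exp (-(1 / (4 * t)) * (x - h) ^ 2) ≤
      Real.exp (1 / (4 * t)) * Real.exp (-(1 / (8 * t)) * x ^ 2) := by
    rw [← Real.exp_add, Real.exp_le_exp]
    have h3 : x ^ 2 ≤ 2 * (x - h) ^ 2 + 2 := by
      have : h ^ 2 ≤ 1 := (sq_le_one_iff_abs_le_one h).2 hh
      nlinarith [sq_nonneg (x - 2 * h)]
    have h4 : 0 < 1 / (8 * t) := by positivity
    have h5 : 1 / (4 * t) = 2 * (1 / (8 * t)) := by field_simp; norm_num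
    rw [h5]
    nlinarith
  calc |x - h| ^ k * Real.exp (-(1 / (4 * t)) * (x - h) ^ 2)
      ≤ (2 * (1 + |x|)) ^ k * (Real.exp (1 / (4 * t)) * Real.exp (-(1 / (8 * t)) * x ^ 2)) := by
        gcongr
    _ = _ := by rw [mul_pow]; ring

theorem integrable_pow_mul_exp_mul {φ : ℝ → ℝ} (hφ : Measurable φ) {B : ℝ} (hB : ∀ x, |φ x| ≤ B)
    (k : ℕ) {t : ℝ} (ht : 0 < t) (y : ℝ) :
    Integrable fun z => ((z - y) ^ k * Real.exp (-(1 / (4 * t)) * (z - y) ^ 2)) * φ z := by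
  have hi : Integrable fun z => ((1 + |z - y|) ^ k * Real.exp (-(1 / (4 * t)) * (z - y) ^ 2)) :=
    (integrable_one_add_abs_pow_mul_exp k (c := 1 / (4 * t)) (by positivity)).comp_sub_right y
  refine (hi.mul_const B).mono' (by fun_prop) (ae_of_all _ fun z => ?_)
  rw [norm_mul, norm_mul, norm_pow, Real.norm_eq_abs, Real.norm_eq_abs, Real.norm_eq_abs,
    Real.abs_exp]
  have hB0 : 0 ≤ B := (abs_nonneg _).trans (hB z)
  gcongr
  · linarith
  · exact hB z

/-- For `k = 0` the truncated `k - 1` is harmless, since its term carries the factor `k`. -/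
theorem hasDerivAt_heatMoment {φ : ℝ → ℝ} (hφ : Measurable φ) {B : ℝ} (hB : ∀ x, |φ x| ≤ B)
    (k : ℕ) {t : ℝ} (ht : 0 < t) (y : ℝ) :
    HasDerivAt (heatMoment φ k t)
      (-k * heatMoment φ (k - 1) t y + 1 / (2 * t) * heatMoment φ (k + 1) t y) y := by
  set q : ℕ → ℝ → ℝ → ℝ := fun j y z => (z - y) ^ j * Real.exp (-(1 / (4 * t)) * (z - y) ^ 2)
    with hq
  have hB0 : 0 ≤ B := (abs_nonneg _).trans (hB 0)
  have hint := fun j y => integrable_pow_mul_exp_mul hφ hB j ht y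
  have hbd : ∀ j, Integrable fun z => 2 ^ j * Real.exp (1 / (4 * t)) *
      ((1 + |z - y|) ^ j * Real.exp (-(1 / (8 * t)) * (z - y) ^ 2)) := fun j =>
    ((integrable_one_add_abs_pow_mul_exp j (c := 1 / (8 * t))
      (by positivity)).comp_sub_right y).const_mul _
  have hle : ∀ j z, ∀ x ∈ Metric.ball y 1, |q j x z| ≤ 2 ^ j * Real.exp (1 / (4 * t)) *
      ((1 + |z - y|) ^ j * Real.exp (-(1 / (8 * t)) * (z - y) ^ 2)) := by
    intro j z x hx
    have := abs_shift_pow_mul_exp_le j ht (h := x - y) (by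
      rw [← Real.dist_eq]; exact (Metric.mem_ball.1 hx).le) (z - y)
    simpa only [hq, sub_sub_sub_cancel_right] using this
  have key := hasDerivAt_integral_of_dominated_loc_of_deriv_le (μ := volume)
    (F := fun y z => q k y z * φ z)
    (F' := fun y z => (-k * q (k - 1) y z + 1 / (2 * t) * q (k + 1) y z) * φ z)
    (bound := fun z => (k * (2 ^ (k - 1) * Real.exp (1 / (4 * t)) *
      ((1 + |z - y|) ^ (k - 1) * Real.exp (-(1 / (8 * t)) * (z - y) ^ 2))) +
      1 / (2 * t) * (2 ^ (k + 1) * Real.exp (1 / (4 * t)) *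
      ((1 + |z - y|) ^ (k + 1) * Real.exp (-(1 / (8 * t)) * (z - y) ^ 2)))) * B)
    (x₀ := y) (Metric.ball_mem_nhds y one_pos)
    (Eventually.of_forall fun x => (hint k x).aestronglyMeasurable) (hint k y)
    (by simp only [hq]; fun_prop) (ae_of_all _ fun z x hx => ?_)
    ((((hbd (k - 1)).const_mul _).add ((hbd (k + 1)).const_mul _)).mul_const B)
    (ae_of_all _ fun z x hx => ?_)
  · have h := key.2
    have e : ∫ z, (-k * q (k - 1) y z + 1 / (2 * t) * q (k + 1) y z) * φ z =
        -k * heatMoment φ (k - 1) t y + 1 / (2 * t) * heatMoment φ (k + 1) t y := by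
      rw [heatMoment, heatMoment, ← integral_const_mul, ← integral_const_mul, ← integral_add
        ((hint _ _).const_mul _) ((hint _ _).const_mul _)]
      congr 1; ext z; simp only [hq]; ring
    rw [← e]; exact h
  · rw [norm_mul, Real.norm_eq_abs, Real.norm_eq_abs]
    refine mul_le_mul ?_ (hB z) (abs_nonneg _) (by positivity)
    refine (abs_add_le _ _).trans ?_
    rw [abs_mul, abs_mul (1 / (2 * t)), abs_neg, Nat.abs_cast, abs_of_pos (by positivity : 0 < 1 / (2 * t))]
    exact add_le_add (mul_le_mul_of_nonneg_left (hle _ _ _ hx) (by positivity))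
      (mul_le_mul_of_nonneg_left (hle _ _ _ hx) (by positivity))
  · refine HasDerivAt.mul_const ?_ _
    have h1 : HasDerivAt (fun y => z - y) (-1) x := by simpa using (hasDerivAt_id x).const_sub z
    have h2 := (h1.fun_pow k).mul (((h1.fun_pow 2).const_mul (-(1 / (4 * t)))).exp)
    refine h2.congr_deriv ?_
    simp only [hq]
    field_simp
    ring

theorem hasDerivAt_heatMoment_time {φ : ℝ → ℝ} (hφ : Measurable φ) {B : ℝ}
    (hB : ∀ x, |φ x| ≤ B) {t : ℝ} (ht : 0 < t) (y : ℝ) :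
    HasDerivAt (fun t => heatMoment φ 0 t y) (1 / (4 * t ^ 2) * heatMoment φ 2 t y) t := by
  have hB0 : 0 ≤ B := (abs_nonneg _).trans (hB 0)
  have hI : Integrable fun z => (1 / t ^ 2 * ((1 + |z - y|) ^ 2 *
      Real.exp (-(1 / (8 * t)) * (z - y) ^ 2))) * B :=
    (((integrable_one_add_abs_pow_mul_exp 2 (c := 1 / (8 * t))
      (by positivity)).comp_sub_right y).const_mul _).mul_const B
  have hs : Ioo (t / 2) (2 * t) ∈ 𝓝 t := Ioo_mem_nhds (by linarith) (by linarith)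
  have key := hasDerivAt_integral_of_dominated_loc_of_deriv_le (μ := volume)
    (F := fun t z => ((z - y) ^ 0 * Real.exp (-(1 / (4 * t)) * (z - y) ^ 2)) * φ z)
    (F' := fun t z => (1 / (4 * t ^ 2) *
      ((z - y) ^ 2 * Real.exp (-(1 / (4 * t)) * (z - y) ^ 2))) * φ z) (x₀ := t) hs
    (by filter_upwards [hs] with s hs'
        exact (integrable_pow_mul_exp_mul hφ hB 0 (by linarith [hs'.1]) y).aestronglyMeasurable)
    (integrable_pow_mul_exp_mul hφ hB 0 ht y) (by fun_prop) (ae_of_all _ fun z s hs' => ?_) hI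
    (ae_of_all _ fun z s hs' => ?_)
  · refine key.2.congr_deriv ?_
    rw [heatMoment, ← integral_const_mul]
    congr 1; ext z; ring
  · have hs0 : 0 < s := by linarith [hs'.1]
    rw [norm_mul, norm_mul, norm_mul, norm_pow, Real.norm_eq_abs (z - y), Real.norm_eq_abs (φ z),
      Real.norm_of_nonneg (by positivity : 0 ≤ 1 / (4 * s ^ 2)),
      Real.norm_of_nonneg (Real.exp_pos _).le]
    have e1 : 1 / (4 * s ^ 2) ≤ 1 / t ^ 2 := by
      apply one_div_le_one_div_of_le (by positivity)
      nlinarith [hs'.1]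
    have e2 : 1 / (8 * t) ≤ 1 / (4 * s) :=
      one_div_le_one_div_of_le (by positivity) (by linarith [hs'.2])
    gcongr
    · linarith [abs_nonneg (z - y)]
    · exact hB z
  · have hs0 : s ≠ 0 := by have := hs'.1; intro h; linarith
    refine HasDerivAt.mul_const ?_ _
    have h1 : HasDerivAt (fun s : ℝ => -(1 / (4 * s)) * (z - y) ^ 2)
        (1 / (4 * s ^ 2) * (z - y) ^ 2) s := by
      have := ((hasDerivAt_inv hs0).const_mul (-(1 / 4) : ℝ)).mul_const ((z - y) ^ 2)
      refine (this.congr_deriv ?_).congr_of_eventuallyEq (Eventually.of_forall fun s => ?_)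
      · field_simp
      · simp only [one_div, mul_inv]; ring
    have := h1.exp
    simp only [pow_zero, one_mul]
    exact this.congr_deriv (by ring)

theorem lineFlow_eq_heatMoment (φ : ℝ → ℝ) {t : ℝ} (ht : 0 < t) (y : ℝ) :
    lineFlow φ t y = (Real.sqrt (4 * Real.pi * t))⁻¹ * heatMoment φ 0 t y := by
  have h2 : (((2 * t).toNNReal : ℝ≥0) : ℝ) = 2 * t := Real.coe_toNNReal _ (by linarith)
  rw [lineFlow, heatMeasure, integral_gaussianReal_eq_integral_smul (toNNReal_two_mul_ne_zero ht),
    heatMoment, ← integral_const_mul, ← integral_add_right_eq_self (fun z => _ * (_ * φ z)) y]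
  congr 1; ext z
  simp only [gaussianPDFReal, h2, smul_eq_mul, sub_zero, pow_zero, add_sub_cancel_right,
    add_comm y z, one_mul]
  rw [show 2 * Real.pi * (2 * t) = 4 * Real.pi * t by ring,
    show -z ^ 2 / (2 * (2 * t)) = -(1 / (4 * t)) * z ^ 2 by field_simp; ring]
  ring

/-- The spatial derivative of the one-dimensional heat flow. -/
def lineFlowDeriv (φ : ℝ → ℝ) (t y : ℝ) : ℝ :=
  (Real.sqrt (4 * Real.pi * t))⁻¹ * (1 / (2 * t) * heatMoment φ 1 t y)

/-- The second spatial derivative of the one-dimensional heat flow. -/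
def lineFlowDerivTwo (φ : ℝ → ℝ) (t y : ℝ) : ℝ :=
  (Real.sqrt (4 * Real.pi * t))⁻¹ *
    (1 / (2 * t) * (-heatMoment φ 0 t y + 1 / (2 * t) * heatMoment φ 2 t y))

theorem hasDerivAt_lineFlow {φ : ℝ → ℝ} (hφ : Measurable φ) {B : ℝ} (hB : ∀ x, |φ x| ≤ B)
    {t : ℝ} (ht : 0 < t) (y : ℝ) :
    HasDerivAt (lineFlow φ t) (lineFlowDeriv φ t y) y := by
  rw [funext (lineFlow_eq_heatMoment φ ht)]
  have := (hasDerivAt_heatMoment hφ hB 0 ht y).const_mul (Real.sqrt (4 * Real.pi * t))⁻¹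
  simpa [lineFlowDeriv] using this

theorem hasDerivAt_lineFlowDeriv {φ : ℝ → ℝ} (hφ : Measurable φ) {B : ℝ} (hB : ∀ x, |φ x| ≤ B)
    {t : ℝ} (ht : 0 < t) (y : ℝ) :
    HasDerivAt (lineFlowDeriv φ t) (lineFlowDerivTwo φ t y) y := by
  have := ((hasDerivAt_heatMoment hφ hB 1 ht y).const_mul (1 / (2 * t))).const_mul
    (Real.sqrt (4 * Real.pi * t))⁻¹
  simpa [lineFlowDerivTwo, funext (lineFlowDeriv.eq_1 φ t)] using this

/-- The one-dimensional heat equation. -/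
theorem hasDerivAt_lineFlow_time {φ : ℝ → ℝ} (hφ : Measurable φ) {B : ℝ} (hB : ∀ x, |φ x| ≤ B)
    {t : ℝ} (ht : 0 < t) (y : ℝ) :
    HasDerivAt (fun t => lineFlow φ t y) (lineFlowDerivTwo φ t y) t := by
  have hp : 0 < 4 * Real.pi * t := by positivity
  have h1 : HasDerivAt (fun s => (Real.sqrt (4 * Real.pi * s))⁻¹)
      (-(1 / (2 * t)) * (Real.sqrt (4 * Real.pi * t))⁻¹) t := by
    have h0 : HasDerivAt (fun s => 4 * Real.pi * s) (4 * Real.pi) t := by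
      simpa using (hasDerivAt_id t).const_mul (4 * Real.pi)
    refine ((h0.sqrt hp.ne').fun_inv (Real.sqrt_ne_zero'.2 hp)).congr_deriv ?_
    rw [Real.sq_sqrt hp.le]
    field_simp
  have h2 := h1.mul (hasDerivAt_heatMoment_time hφ hB ht y)
  refine (h2.congr_deriv ?_).congr_of_eventuallyEq ?_
  · rw [lineFlowDerivTwo]; field_simp; ring
  · filter_upwards [lt_mem_nhds ht] with s hs
    exact lineFlow_eq_heatMoment φ hs y

theorem lipschitzWith_lineFlow {φ : ℝ → ℝ} {L : ℝ≥0} (hφ : LipschitzWith L φ) {B : ℝ}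
    (hB : ∀ x, |φ x| ≤ B) (t : ℝ) : LipschitzWith L (lineFlow φ t) := by
  refine LipschitzWith.of_dist_le_mul fun y y' => ?_
  have hi := integrable_comp_add_of_bdd hφ.continuous.measurable hB (heatMeasure t)
  rw [Real.dist_eq, lineFlow, lineFlow, ← integral_sub (hi y) (hi y')]
  have := norm_integral_le_of_norm_le_const (μ := heatMeasure t)
    (f := fun z => φ (y + z) - φ (y' + z)) (C := L * dist y y') (ae_of_all _ fun z => by
      have := hφ.dist_le_mul (y + z) (y' + z)
      rwa [dist_add_right, Real.dist_eq] at this)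
  simpa using this

theorem abs_lineFlowDeriv_le {φ : ℝ → ℝ} {L : ℝ≥0} (hφ : LipschitzWith L φ) {B : ℝ}
    (hB : ∀ x, |φ x| ≤ B) {t : ℝ} (ht : 0 < t) (y : ℝ) : |lineFlowDeriv φ t y| ≤ L := by
  have h := hasDerivAt_lineFlow hφ.continuous.measurable hB ht y
  rw [← h.deriv]
  exact norm_deriv_le_of_lipschitz (lipschitzWith_lineFlow hφ hB t)

/-! ### A three-function maximum principle on the line -/

/-- If `h'' > 0`, the second derivative test makes `x` a local minimum as well, so `h` is locally
constant and `h'' = 0`. -/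
theorem second_deriv_nonpos_of_isLocalMax {h h' : ℝ → ℝ} {h'' x : ℝ}
    (hh : ∀ s, HasDerivAt h (h' s) s) (hh' : HasDerivAt h' h'' x) (hmax : IsLocalMax h x) :
    h'' ≤ 0 := by
  by_contra! hpos
  have hd : deriv h = h' := funext fun s => (hh s).deriv
  have h1 : deriv (deriv h) x = h'' := by rw [hd]; exact hh'.deriv
  have h0 : deriv h x = 0 := hmax.deriv_eq_zero
  have hmin := isLocalMin_of_deriv_deriv_pos (by rw [h1]; exact hpos) h0 (hh x).continuousAt
  have hc : h =ᶠ[𝓝 x] fun _ => h x := by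
    filter_upwards [hmax, hmin] with s hs1 hs2 using le_antisymm hs1 hs2
  have : deriv (deriv h) x = deriv (deriv fun _ => h x) x := hc.deriv.deriv_eq
  simp [h1] at this
  linarith

/-- Bounded solutions of `v_t = v_yy + G v_y²` on the half-plane `t > 0`, continuous up to
`t = 0`; `p` and `q` are the first and second spatial derivatives of `v`. -/
structure IsGradientSolution (v p q G : ℝ → ℝ → ℝ) (K : ℝ) : Prop where
  cont : ContinuousOn (fun z : ℝ × ℝ => v z.1 z.2) {z | 0 ≤ z.1}
  bdd : ∀ t y, 0 ≤ t → |v t y| ≤ K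
  hasDerivAt : ∀ t y, 0 < t → HasDerivAt (v t) (p t y) y
  hasDerivAt_two : ∀ t y, 0 < t → HasDerivAt (p t) (q t y) y
  hasDerivAt_time : ∀ t y, 0 < t → HasDerivAt (fun s => v s y) (q t y + G t y * p t y ^ 2) t
  slope_bdd : ∀ t y, 0 < t → |p t y| ≤ K
  coeff_bdd : ∀ t y, 0 < t → |G t y| ≤ K

/-- At a maximum of the penalised difference the slopes agree only up to the penalty's gradient
`2x`. This controls the resulting error in the quadratic term. -/
theorem quadratic_error_le {K s l pm p0 G0 x : ℝ}
    (hpm : |pm| ≤ K) (hp0 : |p0| ≤ K) (hG : |G0| ≤ K) (hx : s * (l * (pm - p0)) = 2 * x) :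
    s * (l * (G0 * (pm ^ 2 - p0 ^ 2))) ≤ 4 * K ^ 2 * |x| := by
  have hK : 0 ≤ K := (abs_nonneg _).trans hpm
  have e : s * (l * (G0 * (pm ^ 2 - p0 ^ 2))) = 2 * x * (G0 * (pm + p0)) := by rw [← hx]; ring
  rw [e]
  have h1 : |pm + p0| ≤ 2 * K := (abs_add_le _ _).trans (by linarith)
  calc 2 * x * (G0 * (pm + p0)) ≤ |2 * x * (G0 * (pm + p0))| := le_abs_self _
    _ = 2 * |x| * (|G0| * |pm + p0|) := by rw [abs_mul, abs_mul, abs_mul, abs_two]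
    _ ≤ 2 * |x| * (K * (2 * K)) := by gcongr
    _ = _ := by ring

theorem exists_max_of_le_sub_penalty {N : ℝ → ℝ → ℝ → ℝ} {A η ε : ℝ}
    (hN : ContinuousOn (fun z : ℝ × ℝ × ℝ => N z.1 z.2.1 z.2.2) {z | 0 ≤ z.1})
    (hA : 0 ≤ A) (hη : 0 < η) (hε : 0 < ε)
    (hle : ∀ t y0 y1, 0 ≤ t → N t y0 y1 ≤ A - η * (y0 ^ 2 + y1 ^ 2) - ε * t)
    {t y0 y1 : ℝ} (ht : 0 ≤ t) (hpos : 0 < N t y0 y1) :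
    ∃ τ a0 a1, 0 ≤ τ ∧ 0 < N τ a0 a1 ∧ ∀ s b0 b1, 0 ≤ s → N s b0 b1 ≤ N τ a0 a1 := by
  -- As soon as a coordinate exceeds `R` in size, its penalty alone reaches `A`. So `N ≤ 0` off the
  -- box, and the maximum over the box is global.
  set R : ℝ := 1 + A / ε + A / η + t + |y0| + |y1| with hR
  have a1 : 0 ≤ A / ε := by positivity
  have a2 : 0 ≤ A / η := by positivity
  have c0 := abs_nonneg y0
  have c1 := abs_nonneg y1
  have hR1 : 1 ≤ R := by linarith
  have hRε : A ≤ ε * R := by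
    rw [← div_le_iff₀' hε]; linarith
  have hRη : A ≤ η * R := by
    rw [← div_le_iff₀' hη]; linarith
  have hmem : (t, y0, y1) ∈ Icc 0 R ×ˢ Icc (-R) R ×ˢ Icc (-R) R :=
    ⟨⟨ht, by linarith⟩, abs_le.1 (by linarith), abs_le.1 (by linarith)⟩
  obtain ⟨⟨τ, a0, a1⟩, hτ, hmaxOn⟩ :=
    (isCompact_Icc.prod (isCompact_Icc.prod isCompact_Icc)).exists_isMaxOn
      ⟨_, hmem⟩ (hN.mono fun z hz => hz.1.1)
  have hNmax : 0 < N τ a0 a1 := hpos.trans_le (hmaxOn hmem)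
  refine ⟨τ, a0, a1, hτ.1.1, hNmax, fun s b0 b1 hs => ?_⟩
  by_cases hin : s ≤ R ∧ |b0| ≤ R ∧ |b1| ≤ R
  · exact hmaxOn (a := (s, b0, b1)) ⟨⟨hs, hin.1⟩, abs_le.1 hin.2.1, abs_le.1 hin.2.2⟩
  · refine (hle s b0 b1 hs).trans (le_trans ?_ hNmax.le)
    have q0 : 0 ≤ η * b0 ^ 2 := by positivity
    have q1 : 0 ≤ η * b1 ^ 2 := by positivity
    have q2 : 0 ≤ ε * s := by positivity
    have big : ∀ b : ℝ, R < |b| → A ≤ η * b ^ 2 := by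
      intro b hb
      have h1 : R ≤ b ^ 2 := by
        rw [← sq_abs]; exact hb.le.trans (le_self_pow₀ (hR1.trans hb.le) two_ne_zero)
      exact hRη.trans (by gcongr)
    rw [mul_add]
    by_cases h1 : s ≤ R
    · by_cases h2 : |b0| ≤ R
      · have := big b1 (not_le.1 fun h3 => hin ⟨h1, h2, h3⟩)
        linarith
      · have := big b0 (not_le.1 h2)
        linarith
    · have : ε * R ≤ ε * s := by gcongr; exact (not_le.1 h1).le
      linarith

-- Maximum principle with doubled variables for the difference `C` of the two sides. The factor
-- `exp(-κ t)` absorbs the term `Λ C pm² ≤ κ C`, and the penalties `δ²(y0² + y1²)` and `ε t` force a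
-- maximum to be attained. There the time derivative vanishes, and this expresses `ε` through terms
-- whose sum is smaller than `ε`.
set_option maxHeartbeats 1000000 in
theorem three_function_maximum_principle {vm pm qm Gm v0 p0 q0 G0 v1 p1 q1 G1 : ℝ → ℝ → ℝ}
    {K l m Λ : ℝ} (sm : IsGradientSolution vm pm qm Gm K) (s0 : IsGradientSolution v0 p0 q0 G0 K)
    (s1 : IsGradientSolution v1 p1 q1 G1 K) (hl : 0 < l) (hm : 0 < m) (hlm : l + m = 1)
    (hΛ : 0 ≤ Λ)
    (hstart : ∀ y0 y1, vm 0 (l * y0 + m * y1) ≤ l * v0 0 y0 + m * v1 0 y1)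
    (hG : ∀ t y0 y1, 0 < t → l * v0 t y0 + m * v1 t y1 ≤ vm t (l * y0 + m * y1) →
      Gm t (l * y0 + m * y1) - l * G0 t y0 - m * G1 t y1 ≤
        Λ * (vm t (l * y0 + m * y1) - l * v0 t y0 - m * v1 t y1))
    {t : ℝ} (ht : 0 ≤ t) (y0 y1 : ℝ) :
    vm t (l * y0 + m * y1) ≤ l * v0 t y0 + m * v1 t y1 := by
  by_contra! hcon
  have hK : 0 ≤ K := (abs_nonneg _).trans (sm.bdd 0 0 le_rfl)
  set κ := Λ * K ^ 2 with hκ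
  have hκ0 : 0 ≤ κ := by positivity
  set C : ℝ → ℝ → ℝ → ℝ := fun t y0 y1 =>
    vm t (l * y0 + m * y1) - l * v0 t y0 - m * v1 t y1 with hC
  have hCK : ∀ t y0 y1, 0 ≤ t → C t y0 y1 ≤ 2 * K := by
    intro t y0 y1 ht
    have h1 := (abs_le.1 (sm.bdd t (l * y0 + m * y1) ht)).2
    have h2 := (abs_le.1 (s0.bdd t y0 ht)).1
    have h3 := (abs_le.1 (s1.bdd t y1 ht)).1
    have : l * (-K) + m * (-K) = -K := by rw [← add_mul, hlm, one_mul]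
    have := mul_le_mul_of_nonneg_left h2 hl.le
    have := mul_le_mul_of_nonneg_left h3 hm.le
    simp only [hC]; linarith
  have hD : 0 < C t y0 y1 := by simp only [hC]; linarith
  set D := Real.exp (-κ * t) * C t y0 y1 with hDdef
  have hDpos : 0 < D := by positivity
  set ε := D / (4 * (1 + t)) with hε
  have hεpos : 0 < ε := by positivity
  have hεt : ε * t ≤ D / 4 := by
    rw [hε, div_mul_eq_mul_div, div_le_div_iff₀ (by positivity) (by norm_num)]
    nlinarith
  -- The first bound keeps the penalised function positive at the offending point. The second
  -- collects the errors met at the maximum: `4δ²` from the diagonal second derivative and `4K² δ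
  -- √(2K)` from each slope mismatch.
  obtain ⟨δ, hδpos, hδ1, hδ2⟩ : ∃ δ : ℝ, 0 < δ ∧ δ ^ 2 * (y0 ^ 2 + y1 ^ 2) < D / 4 ∧
      4 * δ ^ 2 + 8 * K ^ 2 * (δ * Real.sqrt (2 * K)) < ε := by
    have e1 : ∀ᶠ δ : ℝ in 𝓝 0, δ ^ 2 * (y0 ^ 2 + y1 ^ 2) < D / 4 := by
      refine (Continuous.tendsto' (by fun_prop) 0 0 (by simp)).eventually_lt_const (by positivity)
    have e2 : ∀ᶠ δ : ℝ in 𝓝 0, 4 * δ ^ 2 + 8 * K ^ 2 * (δ * Real.sqrt (2 * K)) < ε := by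
      refine (Continuous.tendsto' (by fun_prop) 0 0 (by simp)).eventually_lt_const hεpos
    obtain ⟨δ, ⟨h1, h2⟩, h3⟩ := (((e1.and e2).filter_mono nhdsWithin_le_nhds).and
      (self_mem_nhdsWithin : Ioi (0 : ℝ) ∈ 𝓝[>] 0)).exists
    exact ⟨δ, h3, h1, h2⟩
  set N : ℝ → ℝ → ℝ → ℝ := fun t y0 y1 =>
    Real.exp (-κ * t) * C t y0 y1 - δ ^ 2 * (y0 ^ 2 + y1 ^ 2) - ε * t with hN
  have hNpos : 0 < N t y0 y1 := by simp only [hN]; rw [← hDdef]; linarith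
  have hexp : ∀ t, 0 ≤ t → Real.exp (-κ * t) ≤ 1 := fun t ht => by
    rw [Real.exp_le_one_iff]; nlinarith
  have hNle : ∀ t y0 y1, 0 ≤ t → N t y0 y1 ≤ 2 * K - δ ^ 2 * (y0 ^ 2 + y1 ^ 2) - ε * t := by
    intro t y0 y1 ht
    have : Real.exp (-κ * t) * C t y0 y1 ≤ 2 * K := by
      calc Real.exp (-κ * t) * C t y0 y1 ≤ Real.exp (-κ * t) * (2 * K) := by
            gcongr; exact hCK _ _ _ ht
        _ ≤ 1 * (2 * K) := by gcongr; exact hexp t ht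
        _ = _ := one_mul _
    simp only [hN]; linarith
  have hcont : ContinuousOn (fun z : ℝ × ℝ × ℝ => N z.1 z.2.1 z.2.2) {z | 0 ≤ z.1} := by
    have em : ContinuousOn (fun z : ℝ × ℝ × ℝ => vm z.1 (l * z.2.1 + m * z.2.2)) {z | 0 ≤ z.1} :=
      sm.cont.comp (f := fun z : ℝ × ℝ × ℝ => (z.1, l * z.2.1 + m * z.2.2))
        (by fun_prop) fun z hz => hz
    have e0 : ContinuousOn (fun z : ℝ × ℝ × ℝ => v0 z.1 z.2.1) {z | 0 ≤ z.1} :=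
      s0.cont.comp (f := fun z : ℝ × ℝ × ℝ => (z.1, z.2.1)) (by fun_prop) fun z hz => hz
    have e1 : ContinuousOn (fun z : ℝ × ℝ × ℝ => v1 z.1 z.2.2) {z | 0 ≤ z.1} :=
      s1.cont.comp (f := fun z : ℝ × ℝ × ℝ => (z.1, z.2.2)) (by fun_prop) fun z hz => hz
    have f1 : Continuous fun z : ℝ × ℝ × ℝ => Real.exp (-κ * z.1) := by fun_prop
    have f2 : Continuous fun z : ℝ × ℝ × ℝ => δ ^ 2 * (z.2.1 ^ 2 + z.2.2 ^ 2) := by fun_prop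
    have f3 : Continuous fun z : ℝ × ℝ × ℝ => ε * z.1 := by fun_prop
    exact ((f1.continuousOn.mul ((em.sub (e0.const_mul l)).sub (e1.const_mul m))).sub
      f2.continuousOn).sub f3.continuousOn
  obtain ⟨τ, a0, a1, hτ0, hNmax, hglobal⟩ := exists_max_of_le_sub_penalty hcont
    (by positivity) (by positivity) hεpos hNle ht hNpos
  have hsq : 0 ≤ δ ^ 2 * (a0 ^ 2 + a1 ^ 2) := by positivity
  have hτ : 0 < τ := by
    refine lt_of_le_of_ne hτ0 fun h => ?_
    have h1 := hstart a0 a1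
    simp only [hN, hC, ← h, mul_zero, Real.exp_zero, one_mul] at hNmax hsq
    linarith
  set s := Real.exp (-κ * τ) with hs
  have hspos : 0 < s := Real.exp_pos _
  set c := C τ a0 a1 with hc
  have hNeq : N τ a0 a1 = s * c - δ ^ 2 * (a0 ^ 2 + a1 ^ 2) - ε * τ := rfl
  have hετ : 0 < ε * τ := by positivity
  have hsc : 0 < s * c := by linarith
  have hcpos : 0 < c := pos_of_mul_pos_right hsc hspos.le
  have hsc2 : s * c ≤ 2 * K :=
    (mul_le_of_le_one_left hcpos.le (hexp τ hτ0)).trans (hCK τ a0 a1 hτ0)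
  set am := l * a0 + m * a1 with ham
  -- first order conditions
  have hder0 : s * (l * (pm τ am - p0 τ a0)) = 2 * (δ ^ 2 * a0) := by
    have hmx : IsLocalMax (fun x => N τ x a1) a0 :=
      Eventually.of_forall fun x => hglobal τ x a1 hτ0
    have h1 : HasDerivAt (fun x => l * x + m * a1) l a0 := by
      simpa using ((hasDerivAt_id a0).const_mul l).add_const (m * a1)
    have h2 : HasDerivAt (fun x => N τ x a1)
        (s * (pm τ am * l - l * p0 τ a0) - δ ^ 2 * (2 * a0)) a0 := by
      have := ((((sm.hasDerivAt τ am hτ).comp a0 h1).sub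
        ((s0.hasDerivAt τ a0 hτ).const_mul l)).sub_const (m * v1 τ a1)).const_mul s |>.sub
        ((((hasDerivAt_id a0).pow 2).add_const (a1 ^ 2)).const_mul (δ ^ 2)) |>.sub_const (ε * τ)
      refine this.congr_deriv ?_
      simp
    have := hmx.hasDerivAt_eq_zero h2
    linarith
  have hder1 : s * (m * (pm τ am - p1 τ a1)) = 2 * (δ ^ 2 * a1) := by
    have hmx : IsLocalMax (fun x => N τ a0 x) a1 :=
      Eventually.of_forall fun x => hglobal τ a0 x hτ0
    have h1 : HasDerivAt (fun x => l * a0 + m * x) m a1 := by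
      simpa using ((hasDerivAt_id a1).const_mul m).const_add (l * a0)
    have h2 : HasDerivAt (fun x => N τ a0 x)
        (s * (pm τ am * m - m * p1 τ a1) - δ ^ 2 * (2 * a1)) a1 := by
      have := ((((sm.hasDerivAt τ am hτ).comp a1 h1).sub_const (l * v0 τ a0)).sub
        ((s1.hasDerivAt τ a1 hτ).const_mul m)).const_mul s |>.sub
        ((((hasDerivAt_id a1).pow 2).const_add (a0 ^ 2)).const_mul (δ ^ 2)) |>.sub_const (ε * τ)
      refine this.congr_deriv ?_
      simp
    have := hmx.hasDerivAt_eq_zero h2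
    linarith
  have htime : s * ((qm τ am + Gm τ am * pm τ am ^ 2 - l * (q0 τ a0 + G0 τ a0 * p0 τ a0 ^ 2) -
      m * (q1 τ a1 + G1 τ a1 * p1 τ a1 ^ 2)) - κ * c) = ε := by
    have hmx : IsLocalMax (fun x => N x a0 a1) τ := by
      filter_upwards [lt_mem_nhds hτ] with x hx using hglobal x a0 a1 hx.le
    have h1 : HasDerivAt (fun x => Real.exp (-κ * x)) (s * -κ) τ := by
      simpa [hs] using ((hasDerivAt_id τ).const_mul (-κ)).exp
    have h2 := (h1.mul (((sm.hasDerivAt_time τ am hτ).sub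
      ((s0.hasDerivAt_time τ a0 hτ).const_mul l)).sub
      ((s1.hasDerivAt_time τ a1 hτ).const_mul m))).sub_const (δ ^ 2 * (a0 ^ 2 + a1 ^ 2)) |>.sub
      ((hasDerivAt_id τ).const_mul ε)
    have h3 := hmx.hasDerivAt_eq_zero h2
    have h4 : s * -κ * c + s * (qm τ am + Gm τ am * pm τ am ^ 2 -
        l * (q0 τ a0 + G0 τ a0 * p0 τ a0 ^ 2) -
        m * (q1 τ a1 + G1 τ a1 * p1 τ a1 ^ 2)) - ε * 1 = 0 := h3
    linarith
  -- second order condition along the diagonal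
  have hdiag : s * (qm τ am - l * q0 τ a0 - m * q1 τ a1) ≤ 4 * δ ^ 2 := by
    have sh : ∀ b x : ℝ, HasDerivAt (fun x => b + x) 1 x := fun b x =>
      (hasDerivAt_id x).const_add b
    have hdN : ∀ x, HasDerivAt (fun x => N τ (a0 + x) (a1 + x))
        (s * (pm τ (am + x) - l * p0 τ (a0 + x) - m * p1 τ (a1 + x)) -
          δ ^ 2 * (2 * (a0 + x) + 2 * (a1 + x))) x := by
      intro x
      have h1 : HasDerivAt (fun x => vm τ (l * (a0 + x) + m * (a1 + x))) (pm τ (am + x)) x := by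
        have e : (fun x => vm τ (l * (a0 + x) + m * (a1 + x))) = fun x => vm τ (am + x) := by
          funext x; congr 1; rw [ham]; linear_combination x * hlm
        rw [e]
        exact (sm.hasDerivAt τ (am + x) hτ).comp_const_add am x
      have h2 : HasDerivAt (fun x => v0 τ (a0 + x)) (p0 τ (a0 + x)) x := by
        exact (s0.hasDerivAt τ (a0 + x) hτ).comp_const_add a0 x
      have h3 : HasDerivAt (fun x => v1 τ (a1 + x)) (p1 τ (a1 + x)) x := by
        exact (s1.hasDerivAt τ (a1 + x) hτ).comp_const_add a1 x
      have := (((h1.sub (h2.const_mul l)).sub (h3.const_mul m)).const_mul s).sub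
        ((((sh a0 x).pow 2).add ((sh a1 x).pow 2)).const_mul (δ ^ 2)) |>.sub_const (ε * τ)
      refine this.congr_deriv ?_
      simp
    have hd2 : HasDerivAt (fun x => s * (pm τ (am + x) - l * p0 τ (a0 + x) - m * p1 τ (a1 + x)) -
          δ ^ 2 * (2 * (a0 + x) + 2 * (a1 + x)))
        (s * (qm τ am - l * q0 τ a0 - m * q1 τ a1) - δ ^ 2 * (2 * 1 + 2 * 1)) 0 := by
      have h1 : HasDerivAt (fun x => pm τ (am + x)) (qm τ am) 0 := 
        HasDerivAt.comp_const_add am 0 (by simpa using sm.hasDerivAt_two τ am hτ)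
      have h2 : HasDerivAt (fun x => p0 τ (a0 + x)) (q0 τ a0) 0 := 
        HasDerivAt.comp_const_add a0 0 (by simpa using s0.hasDerivAt_two τ a0 hτ)
      have h3 : HasDerivAt (fun x => p1 τ (a1 + x)) (q1 τ a1) 0 := 
        HasDerivAt.comp_const_add a1 0 (by simpa using s1.hasDerivAt_two τ a1 hτ)
      exact (((h1.sub (h2.const_mul l)).sub (h3.const_mul m)).const_mul s).sub
        ((((sh a0 0).const_mul 2).add ((sh a1 0).const_mul 2)).const_mul (δ ^ 2))
    have := second_deriv_nonpos_of_isLocalMax hdN hd2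
      (Eventually.of_forall fun x => by simpa using hglobal τ (a0 + x) (a1 + x) hτ0)
    linarith
  -- conclusion
  have habs : ∀ a : ℝ, δ ^ 2 * a ^ 2 ≤ 2 * K → |δ ^ 2 * a| ≤ δ * Real.sqrt (2 * K) := by
    intro a ha
    have h1 : |δ * a| ≤ Real.sqrt (2 * K) := Real.abs_le_sqrt (by rw [mul_pow]; exact ha)
    calc |δ ^ 2 * a| = δ * |δ * a| := by rw [sq, mul_assoc, abs_mul, abs_of_pos hδpos]
      _ ≤ _ := by gcongr
  have hd0 : 0 ≤ δ ^ 2 * a0 ^ 2 := by positivity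
  have hd1 : 0 ≤ δ ^ 2 * a1 ^ 2 := by positivity
  have hx0 := habs a0 (by linarith)
  have hx1 := habs a1 (by linarith)
  have hpm := sm.slope_bdd τ am hτ
  have err0 := quadratic_error_le hpm (s0.slope_bdd τ a0 hτ) (s0.coeff_bdd τ a0 hτ) hder0
  have err1 := quadratic_error_le hpm (s1.slope_bdd τ a1 hτ) (s1.coeff_bdd τ a1 hτ) hder1
  have hcoef := hG τ a0 a1 hτ (by simp only [hc, hC] at hcpos; linarith)
  have hmain : s * (pm τ am ^ 2 * (Gm τ am - l * G0 τ a0 - m * G1 τ a1)) ≤ s * (κ * c) := by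
    have h1 : pm τ am ^ 2 ≤ K ^ 2 := sq_le_sq' (abs_le.1 hpm).1 (abs_le.1 hpm).2
    have h2 : pm τ am ^ 2 * (Gm τ am - l * G0 τ a0 - m * G1 τ a1) ≤ pm τ am ^ 2 * (Λ * c) :=
      mul_le_mul_of_nonneg_left hcoef (sq_nonneg _)
    have h3 : pm τ am ^ 2 * (Λ * c) ≤ K ^ 2 * (Λ * c) := by gcongr
    have h4 : K ^ 2 * (Λ * c) = κ * c := by rw [hκ]; ring
    exact mul_le_mul_of_nonneg_left (by linarith) hspos.le
  have key : ε = s * (qm τ am - l * q0 τ a0 - m * q1 τ a1) +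
      s * (pm τ am ^ 2 * (Gm τ am - l * G0 τ a0 - m * G1 τ a1)) +
      s * (l * (G0 τ a0 * (pm τ am ^ 2 - p0 τ a0 ^ 2))) +
      s * (m * (G1 τ a1 * (pm τ am ^ 2 - p1 τ a1 ^ 2))) - s * (κ * c) := by
    rw [← htime]; ring
  have b0 : 4 * K ^ 2 * |δ ^ 2 * a0| ≤ 4 * K ^ 2 * (δ * Real.sqrt (2 * K)) := by gcongr
  have b1 : 4 * K ^ 2 * |δ ^ 2 * a1| ≤ 4 * K ^ 2 * (δ * Real.sqrt (2 * K)) := by gcongr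
  linarith

/-! ### The three-function inequality for Gaussian averages -/

/-- The coefficient `-F''/F'²` of the equation `v_t = v_yy + (-F''/F'²)(u) v_y²` satisfied by
`v = F(u)` for a solution `u` of the heat equation. It equals `g_F ∘ F`. -/
def gradCoeff (F : ℝ → ℝ) (r : ℝ) : ℝ := -deriv (deriv F) r / deriv F r ^ 2

theorem hasDerivAt_deriv_of_contDiff_two {F : ℝ → ℝ} (hF : ContDiff ℝ 2 F) (r : ℝ) :
    HasDerivAt (deriv F) (deriv (deriv F) r) r :=
  ((hF.iterate_deriv' 1 1).differentiable one_ne_zero r).hasDerivAt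

theorem continuous_deriv_deriv_of_contDiff_two {F : ℝ → ℝ} (hF : ContDiff ℝ 2 F) :
    Continuous (deriv (deriv F)) := (hF.iterate_deriv' 0 2).continuous

theorem continuous_gradCoeff {F : ℝ → ℝ} (hF : ContDiff ℝ 2 F) (hF' : ∀ r, 0 < deriv F r) :
    Continuous (gradCoeff F) :=
  (continuous_deriv_deriv_of_contDiff_two hF).neg.div ((hF.continuous_deriv one_le_two).pow 2)
    fun r => (pow_pos (hF' r) 2).ne'

theorem abs_le_of_mem_Icc {α β x : ℝ} (hx : x ∈ Icc α β) : |x| ≤ max |α| |β| :=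
  abs_le_max_abs_abs hx.1 hx.2

theorem lineFlow_mem_Icc {φ : ℝ → ℝ} {α β : ℝ} (hφ : Measurable φ) (hαβ : ∀ x, φ x ∈ Icc α β)
    (t y : ℝ) : lineFlow φ t y ∈ Icc α β :=
  integral_mem_Icc (integrable_comp_add_of_bdd hφ (fun x => abs_le_of_mem_Icc (hαβ x)) _ y)
    fun _ => hαβ _

/-- `v_t = F' u_yy` and `v_yy = F'' u_y² + F' u_yy`, so `v_t - v_yy = -F'' u_y²`, which is
`gradCoeff F u` times `v_y²`. The Lipschitz constant bounds the slope up to time zero. One `K`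
serves all three functions. -/
theorem exists_isGradientSolution {F : ℝ → ℝ} (hF : ContDiff ℝ 2 F) (hF' : ∀ r, 0 < deriv F r)
    (α β : ℝ) (L : ℝ≥0) : ∃ K : ℝ, ∀ φ : ℝ → ℝ, LipschitzWith L φ → (∀ x, φ x ∈ Icc α β) →
      IsGradientSolution (fun t y => F (lineFlow φ t y))
        (fun t y => deriv F (lineFlow φ t y) * lineFlowDeriv φ t y)
        (fun t y => deriv (deriv F) (lineFlow φ t y) * lineFlowDeriv φ t y ^ 2 +
          deriv F (lineFlow φ t y) * lineFlowDerivTwo φ t y)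
        (fun t y => gradCoeff F (lineFlow φ t y)) K := by
  have hc1 := hF.continuous_deriv one_le_two
  obtain ⟨K0, hK0⟩ := isCompact_Icc.exists_bound_of_continuousOn
    (hF.continuous.continuousOn (s := Icc α β))
  obtain ⟨K1, hK1⟩ := isCompact_Icc.exists_bound_of_continuousOn (hc1.continuousOn (s := Icc α β))
  obtain ⟨K2, hK2⟩ := isCompact_Icc.exists_bound_of_continuousOn
    ((continuous_gradCoeff hF hF').continuousOn (s := Icc α β))
  refine ⟨max K0 (max (K1 * L) K2), fun φ hφ hαβ => ?_⟩
  have hm := hφ.continuous.measurable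
  have hB := fun x => abs_le_of_mem_Icc (hαβ x)
  have hu := lineFlow_mem_Icc hm hαβ
  have hd := fun r => (hF.differentiable two_ne_zero r).hasDerivAt
  have hd2 := hasDerivAt_deriv_of_contDiff_two hF
  refine ⟨hF.continuous.comp_continuousOn (continuousOn_lineFlow hφ.continuous hB),
    fun t y _ => le_max_of_le_left (hK0 _ (hu t y)), fun t y ht => ?_, fun t y ht => ?_,
    fun t y ht => ?_, fun t y ht => ?_, fun t y _ => le_max_of_le_right (le_max_of_le_right
      (hK2 _ (hu t y)))⟩
  · exact (hd _).comp y (hasDerivAt_lineFlow hm hB ht y)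
  · refine (((hd2 _).comp y (hasDerivAt_lineFlow hm hB ht y)).mul
      (hasDerivAt_lineFlowDeriv hm hB ht y)).congr_deriv ?_
    simp only [Function.comp]; ring
  · refine ((hd _).comp t (hasDerivAt_lineFlow_time hm hB ht y)).congr_deriv ?_
    have := (hF' (lineFlow φ t y)).ne'
    simp only [gradCoeff]; field_simp; ring
  · refine le_max_of_le_right (le_max_of_le_left ?_)
    rw [abs_mul]
    exact mul_le_mul (hK1 _ (hu t y)) (abs_lineFlowDeriv_le hφ hB ht y) (abs_nonneg _)
      ((abs_nonneg _).trans (hK1 _ (hu t y)))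

/-- The bound on `gradCoeff F` on `[α, β]` that makes the three-function inequality work. -/
def CoeffBound (F : ℝ → ℝ) (α β l m Λ : ℝ) : Prop :=
  ∀ rm ∈ Icc α β, ∀ r0 ∈ Icc α β, ∀ r1 ∈ Icc α β, l * F r0 + m * F r1 ≤ F rm →
    gradCoeff F rm - l * gradCoeff F r0 - m * gradCoeff F r1 ≤ Λ * (F rm - l * F r0 - m * F r1)

theorem lineFlow_three_function {F : ℝ → ℝ} (hF : ContDiff ℝ 2 F) (hF' : ∀ r, 0 < deriv F r)
    {α β l m Λ : ℝ} (hl : 0 < l) (hm : 0 < m) (hlm : l + m = 1) (hΛ : 0 ≤ Λ)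
    (hcb : CoeffBound F α β l m Λ) {L : ℝ≥0} {φm φ0 φ1 : ℝ → ℝ}
    (Lm : LipschitzWith L φm) (L0 : LipschitzWith L φ0) (L1 : LipschitzWith L φ1)
    (Im : ∀ x, φm x ∈ Icc α β) (I0 : ∀ x, φ0 x ∈ Icc α β) (I1 : ∀ x, φ1 x ∈ Icc α β)
    (h : ∀ y0 y1, F (φm (l * y0 + m * y1)) ≤ l * F (φ0 y0) + m * F (φ1 y1))
    {t : ℝ} (ht : 0 ≤ t) (y0 y1 : ℝ) :
    F (lineFlow φm t (l * y0 + m * y1)) ≤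
      l * F (lineFlow φ0 t y0) + m * F (lineFlow φ1 t y1) := by
  obtain ⟨K, hK⟩ := exists_isGradientSolution hF hF' α β L
  have Mm := Lm.continuous.measurable
  have M0 := L0.continuous.measurable
  have M1 := L1.continuous.measurable
  refine three_function_maximum_principle (hK φm Lm Im) (hK φ0 L0 I0) (hK φ1 L1 I1) hl hm hlm hΛ
    (fun y0 y1 => ?_) (fun t y0 y1 _ hle => ?_) ht y0 y1
  · simpa only [lineFlow_zero Mm, lineFlow_zero M0, lineFlow_zero M1] using h y0 y1
  · exact hcb _ (lineFlow_mem_Icc Mm Im _ _) _ (lineFlow_mem_Icc M0 I0 _ _) _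
      (lineFlow_mem_Icc M1 I1 _ _) hle

/-! ### From the line to `ℝⁿ`: integrating out one coordinate at a time. -/

theorem integrable_of_lipschitz_of_mem_Icc {n : ℕ} {φ : (Fin n → ℝ) → ℝ} {L : ℝ≥0}
    (hφ : LipschitzWith L φ) {α β : ℝ} (hI : ∀ x, φ x ∈ Icc α β) (t : ℝ) :
    Integrable φ (heatMeasurePi n t) :=
  Integrable.of_bound hφ.continuous.aestronglyMeasurable (max |α| |β|)
    (ae_of_all _ fun x => abs_le_of_mem_Icc (hI x))

theorem integral_heatMeasurePi_succ {n : ℕ} {φ : (Fin (n + 1) → ℝ) → ℝ} {t : ℝ}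
    (hφ : Integrable φ (heatMeasurePi (n + 1) t)) :
    ∫ x, φ x ∂(heatMeasurePi (n + 1) t) =
      ∫ x, lineFlow (fun s => φ (Fin.cons s x)) t 0 ∂(heatMeasurePi n t) := by
  have hp := (measurePreserving_piFinSuccAbove (fun _ : Fin (n + 1) => heatMeasure t) 0).symm
  have hi := (hp.integrable_comp_emb (MeasurableEquiv.measurableEmbedding _)).2 hφ
  have e : ∀ z : ℝ × (Fin n → ℝ), (MeasurableEquiv.piFinSuccAbove (fun _ => ℝ) 0).symm z =
      (Fin.cons z.1 z.2 : Fin (n + 1) → ℝ) := by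
    intro z
    simp [MeasurableEquiv.piFinSuccAbove_symm_apply, Fin.insertNthEquiv]
  rw [heatMeasurePi, ← hp.integral_comp']
  refine (integral_prod_symm _ hi).trans ?_
  simp only [Function.comp, e, lineFlow, zero_add]
  rfl

theorem lipschitzWith_cons_left {n : ℕ} (x : Fin n → ℝ) :
    LipschitzWith 1 fun s : ℝ => (Fin.cons s x : Fin (n + 1) → ℝ) :=
  LipschitzWith.of_dist_le_mul fun s s' => by
    simp only [NNReal.coe_one, one_mul]
    refine (dist_pi_le_iff dist_nonneg).2 fun i => ?_
    cases i using Fin.cases <;> simp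

theorem lipschitzWith_cons_right {n : ℕ} (s : ℝ) :
    LipschitzWith 1 fun x : Fin n → ℝ => (Fin.cons s x : Fin (n + 1) → ℝ) :=
  LipschitzWith.of_dist_le_mul fun x x' => by
    simp only [NNReal.coe_one, one_mul]
    refine (dist_pi_le_iff dist_nonneg).2 fun i => ?_
    cases i using Fin.cases with
    | zero => simp
    | succ i => simpa using dist_le_pi_dist x x' i

theorem lipschitzWith_lineFlow_cons {n : ℕ} {φ : (Fin (n + 1) → ℝ) → ℝ} {L : ℝ≥0}
    (hφ : LipschitzWith L φ) {α β : ℝ} (hI : ∀ x, φ x ∈ Icc α β) (t : ℝ) :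
    LipschitzWith L fun x : Fin n → ℝ => lineFlow (fun s => φ (Fin.cons s x)) t 0 := by
  refine LipschitzWith.of_dist_le_mul fun x x' => ?_
  have hi : ∀ x : Fin n → ℝ, Integrable (fun z => φ (Fin.cons (0 + z) x)) (heatMeasure t) :=
    fun x => integrable_comp_add_of_bdd (φ := fun s => φ (Fin.cons s x))
      (hφ.comp (lipschitzWith_cons_left x)).continuous.measurable
      (fun s => abs_le_of_mem_Icc (hI _)) _ 0
  rw [Real.dist_eq, lineFlow, lineFlow, ← integral_sub (hi x) (hi x')]
  have := norm_integral_le_of_norm_le_const (μ := heatMeasure t)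
    (f := fun z => φ (Fin.cons (0 + z) x) - φ (Fin.cons (0 + z) x')) (C := L * dist x x')
    (ae_of_all _ fun z => by
      have := (hφ.comp (lipschitzWith_cons_right (n := n) (0 + z))).dist_le_mul x x'
      simpa [Real.dist_eq] using this)
  simpa using this

/-- A Brunn–Minkowski type inequality for Gaussian averages of three functions. -/
theorem gaussian_three_function {F : ℝ → ℝ} (hF : ContDiff ℝ 2 F) (hF' : ∀ r, 0 < deriv F r)
    {α β l m Λ : ℝ} (hl : 0 < l) (hm : 0 < m) (hlm : l + m = 1) (hΛ : 0 ≤ Λ)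
    (hcb : CoeffBound F α β l m Λ) {L : ℝ≥0} {t : ℝ} (ht : 0 ≤ t) :
    ∀ {n : ℕ} {φm φ0 φ1 : (Fin n → ℝ) → ℝ},
      LipschitzWith L φm → LipschitzWith L φ0 → LipschitzWith L φ1 →
      (∀ x, φm x ∈ Icc α β) → (∀ x, φ0 x ∈ Icc α β) → (∀ x, φ1 x ∈ Icc α β) →
      (∀ x0 x1, F (φm (l • x0 + m • x1)) ≤ l * F (φ0 x0) + m * F (φ1 x1)) →
      F (∫ x, φm x ∂(heatMeasurePi n t)) ≤
        l * F (∫ x, φ0 x ∂(heatMeasurePi n t)) + m * F (∫ x, φ1 x ∂(heatMeasurePi n t)) := by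
  intro n
  induction n with
  | zero =>
    intro φm φ0 φ1 _ _ _ _ _ _ h
    have e : ∀ φ : (Fin 0 → ℝ) → ℝ, ∫ x, φ x ∂(heatMeasurePi 0 t) = φ 0 := by
      intro φ
      rw [show φ = fun _ => φ 0 from funext fun x => congrArg φ (Subsingleton.elim _ _)]
      simp
    rw [e, e, e]
    simpa using h 0 0
  | succ n ih =>
    intro φm φ0 φ1 Lm L0 L1 Im I0 I1 h
    rw [integral_heatMeasurePi_succ (integrable_of_lipschitz_of_mem_Icc Lm Im t),
      integral_heatMeasurePi_succ (integrable_of_lipschitz_of_mem_Icc L0 I0 t),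
      integral_heatMeasurePi_succ (integrable_of_lipschitz_of_mem_Icc L1 I1 t)]
    have lip : ∀ {φ : (Fin (n + 1) → ℝ) → ℝ}, LipschitzWith L φ → ∀ x : Fin n → ℝ,
        LipschitzWith L fun s => φ (Fin.cons s x) := fun {φ} hφ x => by
      simpa [Function.comp_def] using hφ.comp (lipschitzWith_cons_left x)
    refine ih (lipschitzWith_lineFlow_cons Lm Im t) (lipschitzWith_lineFlow_cons L0 I0 t)
      (lipschitzWith_lineFlow_cons L1 I1 t)
      (fun x => lineFlow_mem_Icc (lip Lm x).continuous.measurable (fun s => Im _) t 0)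
      (fun x => lineFlow_mem_Icc (lip L0 x).continuous.measurable (fun s => I0 _) t 0)
      (fun x => lineFlow_mem_Icc (lip L1 x).continuous.measurable (fun s => I1 _) t 0)
      fun x0 x1 => ?_
    -- With the other coordinates frozen, the hypothesis is a one-dimensional three-function
    -- inequality. Its conclusion at the origin is the hypothesis in one dimension less, with the
    -- same range and Lipschitz constant.
    have key := lineFlow_three_function hF hF' hl hm hlm hΛ hcb (lip Lm (l • x0 + m • x1))
      (lip L0 x0) (lip L1 x1) (fun s => Im _) (fun s => I0 _) (fun s => I1 _)
      (fun y0 y1 => ?_) ht 0 0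
    · simpa using key
    · have e : (Fin.cons (l * y0 + m * y1) (l • x0 + m • x1) : Fin (n + 1) → ℝ) =
          l • (Fin.cons y0 x0 : Fin (n + 1) → ℝ) + m • (Fin.cons y1 x1 : Fin (n + 1) → ℝ) := by
        funext i
        cases i using Fin.cases <;> simp
      rw [e]
      exact h _ _

/-! ### The inverse function -/

theorem Admissible.inverse_apply {F : ℝ → ℝ} (hF : Admissible F) (r : ℝ) :
    inverse F (F r) = r := Function.leftInverse_invFun hF.strictMono.injective r

theorem apply_inverse {F : ℝ → ℝ} {z : ℝ} (hz : z ∈ imageSet F) : F (inverse F z) = z :=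
  Function.invFun_eq hz

theorem Admissible.mem_imageSet_of_mem_Icc {F : ℝ → ℝ} (hF : Admissible F) {a b z : ℝ}
    (hz : z ∈ Icc (F a) (F b)) : z ∈ imageSet F := by
  have hab : a ≤ b := hF.strictMono.le_iff_le.1 (hz.1.trans hz.2)
  obtain ⟨r, _, hr⟩ := intermediate_value_Icc hab hF.continuous.continuousOn hz
  exact ⟨r, hr⟩

theorem Admissible.mem_imageSet_of_le {F : ℝ → ℝ} (hF : Admissible F)
    (htop : Tendsto F atTop atTop) {a z : ℝ} (hz : F a ≤ z) : z ∈ imageSet F := by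
  obtain ⟨b, hb⟩ := (htop.eventually_ge_atTop z).exists
  exact hF.mem_imageSet_of_mem_Icc ⟨hz, hb⟩

theorem Admissible.inverse_le_inverse {F : ℝ → ℝ} (hF : Admissible F) {y z : ℝ}
    (hy : y ∈ imageSet F) (hz : z ∈ imageSet F) (h : y ≤ z) : inverse F y ≤ inverse F z := by
  rwa [← hF.strictMono.le_iff_le, apply_inverse hy, apply_inverse hz]

theorem Admissible.eventually_mem_imageSet {F : ℝ → ℝ} (hF : Admissible F) (r : ℝ) :
    ∀ᶠ y in 𝓝 (F r), y ∈ imageSet F := by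
  filter_upwards [Icc_mem_nhds (hF.strictMono (sub_one_lt r)) (hF.strictMono (lt_add_one r))]
    with y hy using hF.mem_imageSet_of_mem_Icc hy

theorem Admissible.continuousAt_inverse {F : ℝ → ℝ} (hF : Admissible F) {z : ℝ}
    (hz : z ∈ imageSet F) : ContinuousAt (inverse F) z := by
  obtain ⟨r, rfl⟩ := hz
  rw [ContinuousAt, hF.inverse_apply, Metric.tendsto_nhds]
  intro ε hε
  filter_upwards [hF.eventually_mem_imageSet r,
    Ioo_mem_nhds (hF.strictMono (sub_lt_self r hε)) (hF.strictMono (lt_add_of_pos_right r hε))]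
    with y hy hy'
  obtain ⟨s, rfl⟩ := hy
  rw [hF.inverse_apply, Real.dist_eq, abs_lt]
  have h1 := hF.strictMono.lt_iff_lt.1 hy'.1
  have h2 := hF.strictMono.lt_iff_lt.1 hy'.2
  constructor <;> linarith

theorem Admissible.hasDerivAt_inverse {F : ℝ → ℝ} (hF : Admissible F) {r : ℝ}
    (hd : DifferentiableAt ℝ F r) (hr : deriv F r ≠ 0) :
    HasDerivAt (inverse F) (deriv F r)⁻¹ (F r) := by
  refine HasDerivAt.of_local_left_inverse (f := F) (hF.continuousAt_inverse ⟨r, rfl⟩) ?_ hr ?_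
  · rw [hF.inverse_apply]; exact hd.hasDerivAt
  · filter_upwards [hF.eventually_mem_imageSet r] with y hy using apply_inverse hy

/-- Near a point where `F' ≠ 0`, the derivative of the inverse is `1 / F' ∘ f_F`. -/
theorem Admissible.deriv_inverse_eventuallyEq {F : ℝ → ℝ} (hF : Admissible F)
    (h2 : ContDiff ℝ 2 F) {r : ℝ} (hr : 0 < deriv F r) :
    deriv (inverse F) =ᶠ[𝓝 (F r)] fun z => (deriv F (inverse F z))⁻¹ := by
  have hc : ContinuousAt (fun z => deriv F (inverse F z)) (F r) :=
    (h2.continuous_deriv one_le_two).continuousAt.comp (hF.continuousAt_inverse ⟨r, rfl⟩)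
  have hp : ∀ᶠ z in 𝓝 (F r), 0 < deriv F (inverse F z) :=
    hc.eventually (lt_mem_nhds (by simpa only [hF.inverse_apply] using hr))
  filter_upwards [hp, hF.eventually_mem_imageSet r] with z hz hzm
  have := (hF.hasDerivAt_inverse (h2.differentiable two_ne_zero _) hz.ne').deriv
  rwa [apply_inverse hzm] at this

/-- Locally `log f_F' = -log (F' ∘ f_F)`. Positivity of `F'` is asked at one point only, because the
necessity argument uses this before `F' > 0` is known everywhere. -/
theorem Admissible.hasDerivAt_log_deriv_inverse {F : ℝ → ℝ} (hF : Admissible F)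
    (h2 : ContDiff ℝ 2 F) {r : ℝ} (hr : 0 < deriv F r) :
    HasDerivAt (fun z => Real.log (deriv (inverse F) z)) (gradCoeff F r) (F r) := by
  have h1 : HasDerivAt (fun z => deriv F (inverse F z)) (deriv (deriv F) r * (deriv F r)⁻¹)
      (F r) := by
    refine HasDerivAt.comp (h₂ := deriv F) (F r) ?_
      (hF.hasDerivAt_inverse (h2.differentiable two_ne_zero _) hr.ne')
    rw [hF.inverse_apply]
    exact hasDerivAt_deriv_of_contDiff_two h2 r
  have h3 := (h1.log (by rw [hF.inverse_apply]; exact hr.ne')).neg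
  refine (h3.congr_deriv ?_).congr_of_eventuallyEq ?_
  · rw [hF.inverse_apply, gradCoeff]; field_simp
  · filter_upwards [hF.deriv_inverse_eventuallyEq h2 hr] with z hz
    rw [hz, Real.log_inv]; rfl

theorem Admissible.logDerivInverse_apply {F : ℝ → ℝ} (hF : Admissible F)
    (h2 : ContDiff ℝ 2 F) {r : ℝ} (hr : 0 < deriv F r) :
    logDerivInverse F (F r) = gradCoeff F r :=
  (hF.hasDerivAt_log_deriv_inverse h2 hr).deriv

theorem exists_antilipschitz_on_Icc {F : ℝ → ℝ} (h2 : ContDiff ℝ 2 F)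
    (hF' : ∀ r, 0 < deriv F r) (a b : ℝ) :
    ∃ c : ℝ≥0, ∀ r ∈ Icc a b, ∀ s ∈ Icc a b, dist r s ≤ c * dist (F r) (F s) := by
  rcases lt_or_ge b a with hab | hab
  · exact ⟨0, fun r hr => by simp [Icc_eq_empty_of_lt hab] at hr⟩
  obtain ⟨x, -, hx⟩ := isCompact_Icc.exists_isMinOn (nonempty_Icc.2 hab)
    (h2.continuous_deriv one_le_two).continuousOn
  have key := (convex_Icc a b).mul_sub_le_image_sub_of_le_deriv h2.continuous.continuousOn
    (h2.differentiable two_ne_zero).differentiableOn (C := deriv F x)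
    fun y hy => hx (interior_subset hy)
  have hpos := hF' x
  refine ⟨⟨(deriv F x)⁻¹, (inv_pos.2 hpos).le⟩, ?_⟩
  have main : ∀ r ∈ Icc a b, ∀ s ∈ Icc a b, r ≤ s →
      dist r s ≤ (deriv F x)⁻¹ * dist (F r) (F s) := by
    intro r hr s hs hrs
    have h := key r hr s hs hrs
    rw [le_inv_mul_iff₀ hpos, dist_comm, dist_comm (F r), Real.dist_eq, Real.dist_eq,
      abs_of_nonneg (sub_nonneg.2 hrs)]
    exact h.trans (le_abs_self _)
  intro r hr s hs
  rcases le_total r s with h | h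
  · exact main r hr s hs h
  · rw [dist_comm, dist_comm (F r)]; exact main s hs r hr h

/-- Convexity replaces `l g(F r0) + m g(F r1)` by the smaller `g(z)`, where `z = l F r0 + m F r1`.
The slope of `g` from `z` to `F rm` is at most the slope from `F rm` to the point `F ρ = F β + 1`,
whose denominator is at least `1`. So an upper slope bound holds even though `g` need not be
Lipschitz near the left end of `J_F`. -/
theorem Admissible.exists_coeffBound {F : ℝ → ℝ} (hF : Admissible F) (h2 : ContDiff ℝ 2 F)
    (htop : Tendsto F atTop atTop) (hF' : ∀ r, 0 < deriv F r)
    (hg : ConvexOn ℝ (imageSet F) (logDerivInverse F)) (α β : ℝ) {l m : ℝ} (hl : 0 ≤ l)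
    (hm : 0 ≤ m) (hlm : l + m = 1) : ∃ Λ, 0 ≤ Λ ∧ CoeffBound F α β l m Λ := by
  have hgF := fun r => hF.logDerivInverse_apply h2 (hF' r)
  obtain ⟨K, hK⟩ := isCompact_Icc.exists_bound_of_continuousOn
    ((continuous_gradCoeff h2 hF').continuousOn (s := Icc α β))
  obtain ⟨ρ, hρ⟩ := hF.mem_imageSet_of_le htop (show F β ≤ F β + 1 by linarith)
  refine ⟨|gradCoeff F ρ| + |K|, by positivity, fun rm hrm r0 hr0 r1 hr1 hle => ?_⟩
  set z := l * F r0 + m * F r1 with hz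
  have hconv := hg.2 (mem_range_self r0) (mem_range_self r1) hl hm hlm
  simp only [smul_eq_mul, hgF] at hconv
  rw [← hz] at hconv
  rw [sub_sub, sub_sub, ← hz]
  rcases hle.eq_or_lt with h | h
  · rw [h, hgF] at hconv
    rw [h, sub_self, mul_zero]; linarith
  · have hzm : z ∈ imageSet F :=
      hg.1 (mem_range_self r0) (mem_range_self r1) hl hm hlm
    have hrβ : F rm ≤ F β := hF.strictMono.monotone hrm.2
    have h1 : F rm < F ρ := by rw [hρ]; linarith
    have hs := hg.slope_mono_adjacent hzm (mem_range_self ρ) h h1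
    rw [hgF, hgF] at hs
    have h3 : (gradCoeff F ρ - gradCoeff F rm) / (F ρ - F rm) ≤ |gradCoeff F ρ| + |K| := by
      rw [div_le_iff₀ (by linarith)]
      have e1 := le_abs_self (gradCoeff F ρ)
      have e2 := (neg_le_abs (gradCoeff F rm)).trans ((hK rm hrm).trans (le_abs_self K))
      have e3 : 1 ≤ F ρ - F rm := by rw [hρ]; linarith
      have e4 : 0 ≤ |gradCoeff F ρ| + |K| := by positivity
      nlinarith
    have h4 := (div_le_iff₀ (by linarith)).1 (hs.trans h3)
    linarith

/-! ### Lipschitz approximation from below -/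

/-- The infimal convolution of `w` with `k * dist`. -/
def infConv {X : Type*} [PseudoMetricSpace X] (k : ℝ) (w : X → ℝ) (x : X) : ℝ :=
  ⨅ y, (w y + k * dist x y)

section InfConv

variable {X : Type*} [PseudoMetricSpace X] {k b : ℝ} {w : X → ℝ}

theorem bddBelow_infConv (hk : 0 ≤ k) (hb : ∀ y, b ≤ w y) (x : X) :
    BddBelow (range fun y => w y + k * dist x y) :=
  ⟨b, by rintro _ ⟨y, rfl⟩; have := hb y; have := mul_nonneg hk (dist_nonneg (x := x) (y := y))
         simp only; linarith⟩

theorem infConv_le_add (hk : 0 ≤ k) (hb : ∀ y, b ≤ w y) (x y : X) :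
    infConv k w x ≤ w y + k * dist x y := ciInf_le (bddBelow_infConv hk hb x) y

theorem infConv_le (hk : 0 ≤ k) (hb : ∀ y, b ≤ w y) (x : X) : infConv k w x ≤ w x := by
  simpa using infConv_le_add hk hb x x

theorem le_infConv (hk : 0 ≤ k) (hb : ∀ y, b ≤ w y) (x : X) : b ≤ infConv k w x := by
  have : Nonempty X := ⟨x⟩
  refine le_ciInf fun y => ?_
  have := hb y
  have := mul_nonneg hk (dist_nonneg (x := x) (y := y))
  linarith

theorem lipschitzWith_infConv {k : ℝ≥0} (hb : ∀ y, b ≤ w y) :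
    LipschitzWith k (infConv k w) := by
  refine LipschitzWith.of_le_add_mul k fun x x' => ?_
  have : Nonempty X := ⟨x⟩
  rw [← sub_le_iff_le_add]
  refine le_ciInf fun y => ?_
  have h1 := infConv_le_add k.2 hb x y
  have h2 := mul_le_mul_of_nonneg_left (dist_triangle x x' y) k.2
  simp only [NNReal.val_eq_coe] at h1 h2
  linarith

theorem tendsto_infConv_min (hw : Continuous w) (hb : ∀ y, b ≤ w y) {c : ℕ → ℝ}
    (hc : Tendsto c atTop atTop) (hcb : ∀ k, b ≤ c k) (x : X) :
    Tendsto (fun k : ℕ => infConv k (fun y => min (w y) (c k)) x) atTop (𝓝 (w x)) := by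
  have : Nonempty X := ⟨x⟩
  rw [Metric.tendsto_nhds]
  intro ε hε
  obtain ⟨r, hr, hwr⟩ := Metric.continuousAt_iff.1 hw.continuousAt (ε / 2) (by linarith)
  have e1 := hc.eventually_ge_atTop (w x)
  have e2 := (tendsto_natCast_atTop_atTop.atTop_mul_const hr).eventually_ge_atTop (w x - b)
  filter_upwards [e1, e2] with k h1 h2
  have hmb : ∀ y, b ≤ min (w y) (c k) := fun y => le_min (hb y) (hcb k)
  have up := (infConv_le k.cast_nonneg hmb x).trans (min_le_left _ _)
  have low : w x - ε / 2 ≤ infConv k (fun y => min (w y) (c k)) x := by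
    refine le_ciInf fun y => ?_
    have hk : (0 : ℝ) ≤ k := k.cast_nonneg
    rcases lt_or_ge (dist y x) r with hy | hy
    · have h3 := (abs_lt.1 (hwr hy)).1
      have h4 : 0 ≤ (k : ℝ) * dist x y := by positivity
      have h5 : w x - ε / 2 ≤ min (w y) (c k) := le_min (by linarith) (by linarith)
      linarith
    · have h3 : (k : ℝ) * r ≤ k * dist x y := by rw [dist_comm x]; gcongr
      have := hmb y
      linarith
  rw [Real.dist_eq, abs_lt]
  constructor <;> linarith

end InfConv

/-- Competitors `z0` and `z1` on the right give the competitor `l z0 + m z1` on the left, and the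
distance is jointly convex. -/
theorem infConv_three_function {n : ℕ} {k b l m : ℝ} {wm w0 w1 : (Fin n → ℝ) → ℝ} (hk : 0 ≤ k)
    (hl : 0 < l) (hm : 0 < m) (hb : ∀ y, b ≤ wm y)
    (h : ∀ x0 x1, wm (l • x0 + m • x1) ≤ l * w0 x0 + m * w1 x1) (x0 x1 : Fin n → ℝ) :
    infConv k wm (l • x0 + m • x1) ≤ l * infConv k w0 x0 + m * infConv k w1 x1 := by
  have key : ∀ z0 z1, infConv k wm (l • x0 + m • x1) ≤
      l * (w0 z0 + k * dist x0 z0) + m * (w1 z1 + k * dist x1 z1) := by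
    intro z0 z1
    have h1 := infConv_le_add hk hb (l • x0 + m • x1) (l • z0 + m • z1)
    have h2 : dist (l • x0 + m • x1) (l • z0 + m • z1) ≤ l * dist x0 z0 + m * dist x1 z1 := by
      refine (dist_add_add_le _ _ _ _).trans ?_
      rw [dist_smul₀, dist_smul₀, Real.norm_of_nonneg hl.le, Real.norm_of_nonneg hm.le]
    have h3 := mul_le_mul_of_nonneg_left h2 hk
    have := h z0 z1
    nlinarith
  have step : ∀ z1, infConv k wm (l • x0 + m • x1) - m * (w1 z1 + k * dist x1 z1) ≤
      l * infConv k w0 x0 := by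
    intro z1
    rw [← div_le_iff₀' hl]
    refine le_ciInf fun z0 => ?_
    rw [div_le_iff₀' hl]
    linarith [key z0 z1]
  have : (infConv k wm (l • x0 + m • x1) - l * infConv k w0 x0) / m ≤ infConv k w1 x1 := by
    refine le_ciInf fun z1 => ?_
    rw [div_le_iff₀' hm]
    linarith [step z1]
  rw [div_le_iff₀' hm] at this
  linarith

/-- Cutting at `b + k / l` and `b + k / m` ensures that a single active truncation already brings
the right side up to `b + k`, whatever the other term. -/
theorem min_three_function {b k l m wm w0 w1 : ℝ} (hl : 0 < l) (hm : 0 < m) (hlm : l + m = 1)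
    (hk : 0 ≤ k) (h0 : b ≤ w0) (h1 : b ≤ w1) (h : wm ≤ l * w0 + m * w1) :
    min wm (b + k) ≤ l * min w0 (b + k / l) + m * min w1 (b + k / m) := by
  have el : l * (b + k / l) = l * b + k := by field_simp
  have em : m * (b + k / m) = m * b + k := by field_simp
  have hb : l * b + m * b = b := by rw [← add_mul, hlm, one_mul]
  have g0 : l * b ≤ l * w0 := by gcongr
  have g1 : m * b ≤ m * w1 := by gcongr
  rcases le_total w0 (b + k / l) with c0 | c0 <;> rcases le_total w1 (b + k / m) with c1 | c1
  · rw [min_eq_left c0, min_eq_left c1]; exact (min_le_left _ _).trans h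
  · rw [min_eq_left c0, min_eq_right c1, em]; exact (min_le_right _ _).trans (by linarith)
  · rw [min_eq_right c0, min_eq_left c1, el]; exact (min_le_right _ _).trans (by linarith)
  · rw [min_eq_right c0, min_eq_right c1, el, em]; exact (min_le_right _ _).trans (by linarith)

theorem FConvex.continuous {n : ℕ} {F : ℝ → ℝ} (hF : Admissible F) {φ : E n → ℝ}
    (h : FConvex F φ) : Continuous φ := by
  have hw : Continuous fun x => F (φ x) :=
    continuousOn_univ.1 (ConvexOn.continuousOn isOpen_univ h)
  rw [show φ = fun x => inverse F (F (φ x)) from funext fun x => (hF.inverse_apply _).symm]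
  exact continuous_iff_continuousAt.2 fun x =>
    (hF.continuousAt_inverse ⟨φ x, rfl⟩).comp (f := fun x => F (φ x)) hw.continuousAt

/-! ### Sufficiency of the convexity of `g_F` -/

/-- Bounded Lipschitz approximations of `φ` from below, obtained by regularizing `F ∘ φ`. -/
def lipApprox {n : ℕ} (F : ℝ → ℝ) (k : ℕ) (c : ℝ) (φ : (Fin n → ℝ) → ℝ) (x : Fin n → ℝ) : ℝ :=
  inverse F (infConv k (fun y => min (F (φ y)) c) x)

section LipApprox

variable {n : ℕ} {F : ℝ → ℝ} {φ : (Fin n → ℝ) → ℝ} {a c : ℝ}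

theorem infConv_min_mem_Icc (hF : Admissible F) (ha : ∀ x, a ≤ φ x) (hc : F a ≤ c) (k : ℕ)
    (x : Fin n → ℝ) :
    infConv k (fun y => min (F (φ y)) c) x ∈ Icc (F a) (min (F (φ x)) c) := by
  have hb : ∀ y, F a ≤ min (F (φ y)) c := fun y => le_min (hF.strictMono.monotone (ha y)) hc
  exact ⟨le_infConv k.cast_nonneg hb x, infConv_le k.cast_nonneg hb x⟩

theorem apply_lipApprox (hF : Admissible F) (ha : ∀ x, a ≤ φ x) (hc : F a ≤ c) (k : ℕ)
    (x : Fin n → ℝ) : F (lipApprox F k c φ x) = infConv k (fun y => min (F (φ y)) c) x := by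
  have h := infConv_min_mem_Icc hF ha hc k x
  exact apply_inverse (hF.mem_imageSet_of_mem_Icc ⟨h.1, h.2.trans (min_le_left _ _)⟩)

theorem lipApprox_le (hF : Admissible F) (ha : ∀ x, a ≤ φ x) (hc : F a ≤ c) (k : ℕ)
    (x : Fin n → ℝ) : lipApprox F k c φ x ≤ φ x := by
  rw [← hF.strictMono.le_iff_le, apply_lipApprox hF ha hc]
  exact (infConv_min_mem_Icc hF ha hc k x).2.trans (min_le_left _ _)

theorem lipApprox_mem_Icc (hF : Admissible F) (ha : ∀ x, a ≤ φ x) (hc : F a ≤ c) (k : ℕ)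
    {β : ℝ} (hβ : c ≤ F β) (x : Fin n → ℝ) : lipApprox F k c φ x ∈ Icc a β := by
  have h := infConv_min_mem_Icc hF ha hc k x
  rw [← apply_lipApprox hF ha hc] at h
  exact ⟨hF.strictMono.le_iff_le.1 h.1,
    hF.strictMono.le_iff_le.1 (h.2.trans ((min_le_right _ _).trans hβ))⟩

theorem lipschitzWith_lipApprox (hF : Admissible F) (ha : ∀ x, a ≤ φ x) (hc : F a ≤ c) (k : ℕ)
    {β : ℝ} (hβ : c ≤ F β) {C : ℝ≥0}
    (hC : ∀ r ∈ Icc a β, ∀ s ∈ Icc a β, dist r s ≤ C * dist (F r) (F s)) :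
    LipschitzWith (C * k) (lipApprox F k c φ) := by
  refine LipschitzWith.of_dist_le_mul fun x y => ?_
  have hb : ∀ y, F a ≤ min (F (φ y)) c := fun y => le_min (hF.strictMono.monotone (ha y)) hc
  refine (hC _ (lipApprox_mem_Icc hF ha hc k hβ x) _ (lipApprox_mem_Icc hF ha hc k hβ y)).trans ?_
  rw [apply_lipApprox hF ha hc, apply_lipApprox hF ha hc, NNReal.coe_mul, mul_assoc]
  gcongr
  exact (lipschitzWith_infConv (k := (k : ℝ≥0)) hb).dist_le_mul x y

theorem tendsto_lipApprox (hF : Admissible F) (hφ : Continuous φ) (ha : ∀ x, a ≤ φ x)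
    {c : ℕ → ℝ} (hc : ∀ k, F a ≤ c k) (hct : Tendsto c atTop atTop) (x : Fin n → ℝ) :
    Tendsto (fun k => lipApprox F k (c k) φ x) atTop (𝓝 (φ x)) := by
  have h1 := tendsto_infConv_min (hF.continuous.comp hφ)
    (fun y => hF.strictMono.monotone (ha y)) hct hc x
  have h2 := (hF.continuousAt_inverse ⟨φ x, rfl⟩).tendsto.comp h1
  rwa [hF.inverse_apply] at h2

end LipApprox

/-- The three-function inequality for continuous functions that are bounded from below. -/
theorem integral_three_function {n : ℕ} {F : ℝ → ℝ} (hF : Admissible F) (h2 : ContDiff ℝ 2 F)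
    (htop : Tendsto F atTop atTop) (hF' : ∀ r, 0 < deriv F r)
    (hg : ConvexOn ℝ (imageSet F) (logDerivInverse F)) {l m : ℝ} (hl : 0 < l) (hm : 0 < m)
    (hlm : l + m = 1) {t a : ℝ} (ht : 0 ≤ t) {φm φ0 φ1 : (Fin n → ℝ) → ℝ}
    (cm : Continuous φm) (im : Integrable φm (heatMeasurePi n t)) (am : ∀ x, a ≤ φm x)
    (i0 : Integrable φ0 (heatMeasurePi n t)) (a0 : ∀ x, a ≤ φ0 x)
    (i1 : Integrable φ1 (heatMeasurePi n t)) (a1 : ∀ x, a ≤ φ1 x)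
    (h : ∀ x0 x1, F (φm (l • x0 + m • x1)) ≤ l * F (φ0 x0) + m * F (φ1 x1)) :
    F (∫ x, φm x ∂(heatMeasurePi n t)) ≤
      l * F (∫ x, φ0 x ∂(heatMeasurePi n t)) + m * F (∫ x, φ1 x ∂(heatMeasurePi n t)) := by
  set b := F a
  have hcm : ∀ k : ℕ, b ≤ b + k := fun k => by have : (0 : ℝ) ≤ k := k.cast_nonneg
                                               linarith
  have hc0 : ∀ k : ℕ, b ≤ b + k / l := fun k => by have : (0 : ℝ) ≤ k / l := by positivity
                                                   linarith
  have hc1 : ∀ k : ℕ, b ≤ b + k / m := fun k => by have : (0 : ℝ) ≤ k / m := by positivity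
                                                   linarith
  have htk : Tendsto (fun k : ℕ => b + (k : ℝ)) atTop atTop :=
    tendsto_atTop_add_const_left _ _ tendsto_natCast_atTop_atTop
  -- On the right the approximations lie below `φ0` and `φ1`, so monotonicity suffices there. Only
  -- `φm` requires a limit.
  have approx : ∀ k : ℕ, F (∫ x, lipApprox F k (b + k) φm x ∂(heatMeasurePi n t)) ≤
      l * F (∫ x, φ0 x ∂(heatMeasurePi n t)) + m * F (∫ x, φ1 x ∂(heatMeasurePi n t)) := by
    intro k
    obtain ⟨β, hβ⟩ := (htop.eventually_ge_atTop (max (b + k) (max (b + k / l) (b + k / m)))).exists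
    have βm : b + k ≤ F β := (le_max_left _ _).trans hβ
    have β0 : b + k / l ≤ F β := (le_max_left _ _).trans ((le_max_right _ _).trans hβ)
    have β1 : b + k / m ≤ F β := (le_max_right _ _).trans ((le_max_right _ _).trans hβ)
    obtain ⟨C, hC⟩ := exists_antilipschitz_on_Icc h2 hF' a β
    obtain ⟨Λ, hΛ, hcb⟩ := hF.exists_coeffBound h2 htop hF' hg a β hl.le hm.le hlm
    have L0 := lipschitzWith_lipApprox hF a0 (hc0 k) k β0 hC
    have L1 := lipschitzWith_lipApprox hF a1 (hc1 k) k β1 hC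
    have I0 := lipApprox_mem_Icc hF a0 (hc0 k) k β0
    have I1 := lipApprox_mem_Icc hF a1 (hc1 k) k β1
    have key := gaussian_three_function h2 hF' hl hm hlm hΛ hcb ht
      (lipschitzWith_lipApprox hF am (hcm k) k βm hC) L0 L1
      (lipApprox_mem_Icc hF am (hcm k) k βm) I0 I1 (fun x0 x1 => by
        rw [apply_lipApprox hF am (hcm k), apply_lipApprox hF a0 (hc0 k),
          apply_lipApprox hF a1 (hc1 k)]
        exact infConv_three_function k.cast_nonneg hl hm
          (fun y => le_min (hF.strictMono.monotone (am y)) (hcm k))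
          (fun z0 z1 => min_three_function hl hm hlm k.cast_nonneg
            (hF.strictMono.monotone (a0 z0)) (hF.strictMono.monotone (a1 z1)) (h z0 z1)) x0 x1)
    refine key.trans (add_le_add ?_ ?_)
    · exact mul_le_mul_of_nonneg_left (hF.strictMono.monotone (integral_mono
        (integrable_of_lipschitz_of_mem_Icc L0 I0 t) i0 (lipApprox_le hF a0 (hc0 k) k))) hl.le
    · exact mul_le_mul_of_nonneg_left (hF.strictMono.monotone (integral_mono
        (integrable_of_lipschitz_of_mem_Icc L1 I1 t) i1 (lipApprox_le hF a1 (hc1 k) k))) hm.le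
  have hlim : Tendsto (fun k : ℕ => ∫ x, lipApprox F k (b + k) φm x ∂(heatMeasurePi n t)) atTop
      (𝓝 (∫ x, φm x ∂(heatMeasurePi n t))) := by
    refine tendsto_integral_of_dominated_convergence (fun x => |a| + |φm x|) (fun k => ?_)
      ((integrable_const _).add im.abs) (fun k => ae_of_all _ fun x => ?_)
      (ae_of_all _ fun x => tendsto_lipApprox hF cm am hcm htk x)
    · obtain ⟨β, hβ⟩ := (htop.eventually_ge_atTop (b + k)).exists
      obtain ⟨C, hC⟩ := exists_antilipschitz_on_Icc h2 hF' a β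
      exact (lipschitzWith_lipApprox hF am (hcm k) k hβ hC).continuous.aestronglyMeasurable
    · obtain ⟨β, hβ⟩ := (htop.eventually_ge_atTop (b + k)).exists
      have e1 := (lipApprox_mem_Icc hF am (hcm k) k hβ x).1
      have e2 := lipApprox_le hF am (hcm k) k x
      refine (abs_le_max_abs_abs e1 e2).trans (max_le ?_ ?_)
      · linarith [abs_nonneg (φm x)]
      · linarith [abs_nonneg a]
  exact le_of_tendsto' ((hF.continuous.tendsto _).comp hlim) approx

theorem preserved_of_convexOn {n : ℕ} {F : ℝ → ℝ} (hF : Admissible F) (h2 : ContDiff ℝ 2 F)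
    (htop : Tendsto F atTop atTop) (hF' : ∀ r, 0 < deriv F r)
    (hg : ConvexOn ℝ (imageSet F) (logDerivInverse F)) : Preserved n F := by
  rintro φ ⟨a, ha⟩ hφ - t ht htT
  have ha' : ∀ x, a ≤ φ x := fun x => ha (mem_range_self x)
  have hc := hφ.continuous hF
  have hi := integrable_of_lt_existenceTime ht htT
  refine ⟨convex_univ, fun x0 _ x1 _ l m hl hm hlm => ?_⟩
  rcases hl.eq_or_lt with rfl | hl
  · simp only [zero_add] at hlm; simp [hlm]
  rcases hm.eq_or_lt with rfl | hm
  · simp only [add_zero] at hlm; simp [hlm]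
  simp only [heatFlow_eq_integral ht, smul_eq_mul]
  refine integral_three_function hF h2 htop hF' hg hl hm hlm ht.le
    (hc.comp (continuous_const.add (PiLp.continuous_toLp 2 _))) (hi _) (fun _ => ha' _)
    (hi x0) (fun _ => ha' _) (hi x1) (fun _ => ha' _) fun z0 z1 => ?_
  have e : l • x0 + m • x1 + WithLp.toLp 2 (l • z0 + m • z1) =
      l • (x0 + WithLp.toLp 2 z0) + m • (x1 + WithLp.toLp 2 z1) := by
    simp only [WithLp.toLp_add, WithLp.toLp_smul, smul_add]; abel
  rw [e]
  exact hφ.2 (mem_univ _) (mem_univ _) hl.le hm.le hlm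

/-! ### Triviality -/

/-- `y` is the convex combination of `x` and `x + s (y - x)` with weight `1 / s` on the latter. -/
theorem convexOn_linear_growth {V : Type*} [AddCommGroup V] [Module ℝ V] {w : V → ℝ}
    (hw : ConvexOn ℝ univ w) (x y : V) {s : ℝ} (hs : 1 ≤ s) :
    w x + s * (w y - w x) ≤ w (x + s • (y - x)) := by
  have hs0 : 0 < s := by linarith
  have h := hw.2 (mem_univ x) (mem_univ (x + s • (y - x)))
    (sub_nonneg.2 (inv_le_one_of_one_le₀ hs)) (inv_pos.2 hs0).le (sub_add_cancel _ _)
  have e : (1 - s⁻¹) • x + s⁻¹ • (x + s • (y - x)) = y := by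
    rw [smul_add, smul_smul, inv_mul_cancel₀ hs0.ne', sub_smul, one_smul, one_smul]; abel
  rw [e, smul_eq_mul, smul_eq_mul] at h
  have h2 := mul_le_mul_of_nonneg_left h hs0.le
  have e2 : s * ((1 - s⁻¹) * w x + s⁻¹ * w (x + s • (y - x))) =
      s * w x - w x + w (x + s • (y - x)) := by field_simp
  rw [e2] at h2
  linarith

theorem convexOn_const_of_le {V : Type*} [AddCommGroup V] [Module ℝ V] {w : V → ℝ}
    (hw : ConvexOn ℝ univ w) {M : ℝ} (hM : ∀ x, w x ≤ M) (x y : V) : w x = w y := by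
  have key : ∀ x y, w y ≤ w x := by
    intro x y
    by_contra! h
    have hd : 0 < w y - w x := by linarith
    have hq : 0 ≤ (M - w x) / (w y - w x) := div_nonneg (by linarith [hM x]) hd.le
    have h1 := convexOn_linear_growth hw x y (s := (M - w x) / (w y - w x) + 1) (by linarith)
    have h2 : (M - w x) / (w y - w x) * (w y - w x) = M - w x := by field_simp
    have := hM (x + ((M - w x) / (w y - w x) + 1) • (y - x))
    rw [add_mul, h2] at h1
    linarith
  exact le_antisymm (key y x) (key x y)

theorem onlyTriviallyPreserved_of_tendsto_nhds {n : ℕ} {F : ℝ → ℝ} (hF : Admissible F) {L : ℝ}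
    (hL : Tendsto F atTop (𝓝 L)) : OnlyTriviallyPreserved n F := by
  intro φ _ hφ _ _
  refine ⟨φ 0, fun x => hF.strictMono.injective ?_⟩
  exact convexOn_const_of_le hφ (fun x => hF.strictMono.monotone.ge_of_tendsto hL (φ x)) x 0

theorem integrable_exp_mul_of_integrable_heatMeasure {ψ : ℝ → ℝ} {t : ℝ} (ht : 0 < t)
    (h : Integrable ψ (heatMeasure t)) :
    Integrable fun s => Real.exp (-s ^ 2 / (4 * t)) * ψ s := by
  have h2 : (((2 * t).toNNReal : ℝ≥0) : ℝ) = 2 * t := Real.coe_toNNReal _ (by linarith)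
  rw [heatMeasure, gaussianReal_of_var_ne_zero _ (toNNReal_two_mul_ne_zero ht),
    integrable_withDensity_iff_integrable_smul' (measurable_gaussianPDF _ _)
      (ae_of_all _ fun _ => gaussianPDF_lt_top)] at h
  refine (h.const_mul (Real.sqrt (4 * Real.pi * t))).congr (ae_of_all _ fun s => ?_)
  have hp : Real.sqrt (4 * Real.pi * t) ≠ 0 := Real.sqrt_ne_zero'.2 (by positivity)
  simp only [toReal_gaussianPDF, gaussianPDFReal, h2, smul_eq_mul, sub_zero]
  rw [show 2 * Real.pi * (2 * t) = 4 * Real.pi * t by ring,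
    show 2 * (2 * t) = 4 * t by ring]
  field_simp

/-- The exponent `A = p² / (2t)` comes from `(p z + q)² ≤ 2 p² z² + 2 q²`: up to a constant,
`e^{-Az²}` is below the heat kernel at `p z + q`. On the bounded piece up to `Z` the integrand is at
most `f_F(Z)`. -/
theorem gaussIntegral_lt_top_of_le {F : ℝ → ℝ} (hF : Admissible F) (htop : Tendsto F atTop atTop)
    {ψ : ℝ → ℝ} {t : ℝ} (ht : 0 < t) (hψ : Integrable ψ (heatMeasure t)) {p q Z : ℝ} (hp : p ≠ 0)
    (hZ : F 1 ≤ Z) (hle : ∀ z, Z ≤ z → inverse F z ≤ ψ (p * z + q)) :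
    gaussIntegral F (p ^ 2 / (2 * t)) < ⊤ := by
  set A := p ^ 2 / (2 * t) with hA
  have hA0 : 0 ≤ A := by positivity
  have hf1 : ∀ z, F 1 ≤ z → 1 ≤ inverse F z := fun z hz => by
    have := hF.inverse_le_inverse ⟨1, rfl⟩ (hF.mem_imageSet_of_le htop hz) hz
    rwa [hF.inverse_apply] at this
  have hint : Integrable fun z => Real.exp (q ^ 2 / (2 * t)) *
      (Real.exp (-(p * z + q) ^ 2 / (4 * t)) * ψ (p * z + q)) :=
    (((integrable_exp_mul_of_integrable_heatMeasure ht hψ).comp_add_right q).comp_mul_left'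
      hp).const_mul _
  have hbound : ∀ z ∈ Ici Z, Real.exp (-A * z ^ 2) * inverse F z ≤
      Real.exp (q ^ 2 / (2 * t)) * (Real.exp (-(p * z + q) ^ 2 / (4 * t)) * ψ (p * z + q)) := by
    intro z hz
    have h1 := hf1 z (hZ.trans hz)
    rw [← mul_assoc, ← Real.exp_add]
    refine mul_le_mul (Real.exp_le_exp.2 ?_) (hle z hz) (by linarith) (Real.exp_pos _).le
    have e : q ^ 2 / (2 * t) + -(p * z + q) ^ 2 / (4 * t) - -A * z ^ 2 =
        (p * z - q) ^ 2 / (4 * t) := by rw [hA]; field_simp; ring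
    have : 0 ≤ (p * z - q) ^ 2 / (4 * t) := by positivity
    linarith
  have hsplit : Ici (F 1) ⊆ Icc (F 1) Z ∪ Ici Z := fun z hz => by
    rcases le_total z Z with h | h
    · exact Or.inl ⟨hz, h⟩
    · exact Or.inr h
  refine (lintegral_mono_set hsplit).trans_lt ((lintegral_union_le _ _ _).trans_lt
    (ENNReal.add_lt_top.2 ⟨?_, ?_⟩))
  · refine (setLIntegral_mono' measurableSet_Icc fun z hz => ENNReal.ofReal_le_ofReal
      (show _ ≤ inverse F Z from ?_)).trans_lt ?_
    · have h1 := hf1 z hz.1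
      have h2 := hF.inverse_le_inverse (hF.mem_imageSet_of_le htop hz.1)
        (hF.mem_imageSet_of_le htop hZ) hz.2
      have h3 : Real.exp (-A * z ^ 2) ≤ 1 := Real.exp_le_one_iff.2 (by nlinarith [sq_nonneg z])
      nlinarith
    · rw [setLIntegral_const, Real.volume_Icc]
      exact ENNReal.mul_lt_top ENNReal.ofReal_lt_top ENNReal.ofReal_lt_top
  · refine (setLIntegral_mono' measurableSet_Ici fun z hz => (ENNReal.ofReal_le_ofReal
      (hbound z hz)).trans (Real.ofReal_le_enorm _)).trans_lt ?_
    exact (setLIntegral_le_lintegral _ _).trans_lt hint.2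

instance isOpenPosMeasure_heatMeasurePi {n : ℕ} {t : ℝ} [h : Fact (0 < t)] :
    (heatMeasurePi n t).IsOpenPosMeasure := by
  have : (heatMeasure t).IsOpenPosMeasure :=
    (gaussianReal_absolutelyContinuous' 0 (toNNReal_two_mul_ne_zero h.out)).isOpenPosMeasure
  unfold heatMeasurePi
  infer_instance

theorem toLp_insertNth_line {n : ℕ} (i : Fin (n + 1)) (x : Fin n → ℝ) (s0 s1 s : ℝ) :
    (WithLp.toLp 2 (i.insertNth s0 x : Fin (n + 1) → ℝ) : E (n + 1)) +
      s • (WithLp.toLp 2 (i.insertNth s1 x : Fin (n + 1) → ℝ) -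
        WithLp.toLp 2 (i.insertNth s0 x : Fin (n + 1) → ℝ)) =
      WithLp.toLp 2 (i.insertNth (s0 + s * (s1 - s0)) x : Fin (n + 1) → ℝ) := by
  ext j
  cases j using Fin.succAboveCases i <;> simp

/-- A function on `ℝⁿ` that is constant on every line parallel to an axis is constant. -/
theorem eq_of_forall_insertNth_eq {n : ℕ} {Φ : (Fin (n + 1) → ℝ) → ℝ}
    (h : ∀ i x s0 s1, Φ (Fin.insertNth i s0 x) = Φ (Fin.insertNth i s1 x)) (x : Fin (n + 1) → ℝ) :
    Φ x = Φ 0 := by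
  have upd : ∀ (y : Fin (n + 1) → ℝ) i v, Φ (Function.update y i v) = Φ y := by
    intro y i v
    have h1 := h i (i.removeNth y) v (y i)
    rwa [Fin.insertNth_removeNth, Fin.insertNth_self_removeNth] at h1
  have main : ∀ s : Finset (Fin (n + 1)), Φ (s.piecewise x 0) = Φ 0 := by
    intro s
    induction s using Finset.induction_on with
    | empty => simp
    | insert i s _ ih => rw [Finset.piecewise_insert, upd, ih]
  simpa using main Finset.univ

theorem onlyTriviallyPreserved_of_gaussIntegral_eq_top {n : ℕ} (hn : 1 ≤ n) {F : ℝ → ℝ}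
    (hF : Admissible F) (htop : Tendsto F atTop atTop)
    (hA : ∀ A : ℝ, 0 < A → gaussIntegral F A = ⊤) : OnlyTriviallyPreserved n F := by
  rintro φ - hφ hT -
  obtain ⟨n, rfl⟩ : ∃ k, n = k + 1 := ⟨n - 1, by omega⟩
  obtain ⟨t, ht, htT⟩ := exists_pos_lt_of_pos hT
  have hi := integrable_of_lt_existenceTime ht htT 0
  simp only [zero_add] at hi
  have hc := hφ.continuous hF
  set Φ : (Fin (n + 1) → ℝ) → ℝ := fun z => φ (WithLp.toLp 2 z) with hΦ
  have hΦc : Continuous Φ := hc.comp (PiLp.continuous_toLp 2 _)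
  have line : ∀ (i : Fin (n + 1)) (x : Fin n → ℝ),
      Integrable (fun s => Φ (i.insertNth s x)) (heatMeasure t) →
      ∀ s0 s1, Φ (i.insertNth s0 x) ≤ Φ (i.insertNth s1 x) := by
    intro i x hx s1 s0
    by_contra! hlt
    have hd : s1 ≠ s0 := by rintro rfl; exact lt_irrefl _ hlt
    set c := F (Φ (i.insertNth s0 x)) with hcdef
    set k := F (Φ (i.insertNth s1 x)) - c with hk
    have hkpos : 0 < k := sub_pos.2 (hF.strictMono hlt)
    have hd' : s1 - s0 ≠ 0 := sub_ne_zero.2 hd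
    have hp : (s1 - s0) / k ≠ 0 := div_ne_zero hd' hkpos.ne'
    -- `p z + q` is the parameter at which the affine lower bound for `F ∘ Φ` along the line takes
    -- the value `z`. Beyond `c + k` it lies past `s1`, where linear growth applies.
    have hlt' := gaussIntegral_lt_top_of_le hF htop ht hx (p := (s1 - s0) / k)
      (q := s0 - c * (s1 - s0) / k) (Z := max (F 1) (c + k)) hp (le_max_left _ _) (fun z hz => ?_)
    · rw [hA _ (by positivity)] at hlt'
      exact lt_irrefl _ hlt'
    · have hz2 : c + k ≤ z := (le_max_right _ _).trans hz
      have hs : 1 ≤ (z - c) / k := by rw [le_div_iff₀ hkpos]; linarith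
      have hgrow := convexOn_linear_growth hφ (WithLp.toLp 2 (i.insertNth s0 x))
        (WithLp.toLp 2 (i.insertNth s1 x)) hs
      rw [toLp_insertNth_line] at hgrow
      have e1 : s0 + (z - c) / k * (s1 - s0) = (s1 - s0) / k * z + (s0 - c * (s1 - s0) / k) := by
        field_simp; ring
      have e2 : c + (z - c) / k * k = z := by field_simp; ring
      have h3 : z ≤ F (Φ (i.insertNth ((s1 - s0) / k * z + (s0 - c * (s1 - s0) / k)) x)) := by
        rw [e1] at hgrow
        exact e2.symm.le.trans hgrow
      have := hF.inverse_le_inverse (hF.mem_imageSet_of_le htop ((le_max_left _ _).trans hz))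
        ⟨_, rfl⟩ h3
      rwa [hF.inverse_apply] at this
  have hconst : ∀ (i : Fin (n + 1)) (x : Fin n → ℝ) (s0 s1 : ℝ),
      Φ (i.insertNth s0 x) = Φ (i.insertNth s1 x) := by
    intro i
    have : Fact (0 < t) := ⟨ht⟩
    have hmp := (measurePreserving_piFinSuccAbove (fun _ : Fin (n + 1) => heatMeasure t) i).symm
    have hprod := (hmp.integrable_comp_emb (MeasurableEquiv.measurableEmbedding _)).2 hi
    have hae : ∀ᵐ x ∂(heatMeasurePi n t), ∀ s0 s1,
        Φ (i.insertNth s0 x) = Φ (i.insertNth s1 x) := by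
      filter_upwards [hprod.prod_left_ae] with x hx s0 s1
      have hx' : Integrable (fun s => Φ (i.insertNth s x)) (heatMeasure t) := hx
      exact le_antisymm (line i x hx' s0 s1) (line i x hx' s1 s0)
    have hclosed : IsClosed {x : Fin n → ℝ | ∀ s0 s1,
        Φ (i.insertNth s0 x) = Φ (i.insertNth s1 x)} := by
      simp only [ofPred_forall]
      refine isClosed_iInter fun s0 => isClosed_iInter fun s1 => isClosed_eq ?_ ?_ <;>
      exact hΦc.comp (by fun_prop)
    -- The Gaussian measure charges every nonempty open set, so a property valid almost everywhere
    -- holds on a dense set. This one is also closed.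
    have hdense := Measure.dense_of_ae hae
    intro x
    have : x ∈ closure {x : Fin n → ℝ | ∀ s0 s1,
        Φ (i.insertNth s0 x) = Φ (i.insertNth s1 x)} := hdense x
    rwa [hclosed.closure_eq] at this
  exact ⟨Φ 0, fun x => eq_of_forall_insertNth_eq hconst x.ofLp⟩

/-! ### Necessity: short-time asymptotics -/

/-- Against the density `e^{-z²/2}`, growth `e^{z²/4}` still leaves a factor `e^{-z²/4}`. -/
theorem integrable_gaussianReal_of_le {g : ℝ → ℝ} (hg : Measurable g) {C : ℝ}
    (h : ∀ z, |g z| ≤ C * (z ^ 2 * Real.exp (z ^ 2 / 4) + Real.exp (z ^ 2 / 4))) :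
    Integrable g (gaussianReal 0 1) := by
  rw [gaussianReal_of_var_ne_zero _ one_ne_zero, integrable_withDensity_iff_integrable_smul'
    (measurable_gaussianPDF _ _) (ae_of_all _ fun _ => gaussianPDF_lt_top)]
  have hi := (((integrable_one_add_abs_pow_mul_exp 2 (c := 1 / 4) (by norm_num)).add
    (integrable_one_add_abs_pow_mul_exp 0 (c := 1 / 4) (by norm_num))).const_mul
      ((Real.sqrt (2 * Real.pi * 1))⁻¹ * C))
  have hC : 0 ≤ C := by
    have := (abs_nonneg _).trans (h 0)
    simpa using this
  refine hi.mono' (by simp only [toReal_gaussianPDF]; fun_prop) (ae_of_all _ fun z => ?_)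
  simp only [toReal_gaussianPDF, gaussianPDFReal, smul_eq_mul, norm_mul, Real.norm_eq_abs,
    sub_zero, NNReal.coe_one, Pi.add_apply, pow_zero, one_mul]
  have hinv : 0 ≤ (Real.sqrt (2 * Real.pi * 1))⁻¹ := by positivity
  generalize (Real.sqrt (2 * Real.pi * 1))⁻¹ = κ at hinv ⊢
  rw [abs_of_nonneg hinv, Real.abs_exp, mul_assoc, mul_assoc]
  refine mul_le_mul_of_nonneg_left ?_ hinv
  calc Real.exp (-z ^ 2 / (2 * 1)) * |g z|
      ≤ Real.exp (-z ^ 2 / (2 * 1)) *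
        (C * (z ^ 2 * Real.exp (z ^ 2 / 4) + Real.exp (z ^ 2 / 4))) := by gcongr; exact h z
    _ = C * (z ^ 2 * (Real.exp (-z ^ 2 / (2 * 1)) * Real.exp (z ^ 2 / 4)) +
        Real.exp (-z ^ 2 / (2 * 1)) * Real.exp (z ^ 2 / 4)) := by ring
    _ = C * (z ^ 2 * Real.exp (-(1 / 4) * z ^ 2) + Real.exp (-(1 / 4) * z ^ 2)) := by
        rw [← Real.exp_add]; ring_nf
    _ ≤ _ := by
        have hz : z ^ 2 ≤ (1 + |z|) ^ 2 := by
          rw [← sq_abs]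
          gcongr
          linarith
        gcongr

theorem exp_growth_shift {ψ : ℝ → ℝ} {M B : ℝ} (hB : 0 < B)
    (hψ : ∀ y, |ψ y| ≤ M * Real.exp (B * y ^ 2)) (x h : ℝ) :
    |ψ (x + h)| ≤ M * Real.exp (2 * B * x ^ 2) * Real.exp (2 * B * h ^ 2) := by
  have hM : 0 ≤ M := by simpa using (abs_nonneg _).trans (hψ 0)
  refine (hψ _).trans ?_
  rw [mul_assoc, ← Real.exp_add]
  gcongr
  nlinarith [mul_nonneg hB.le (sq_nonneg (x - h))]

/-- The threshold `1 / (16B)` is exactly where `2B · 2t = 1/4`. -/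
theorem exp_sqrt_le {B t : ℝ} (ht : 0 ≤ t) (htB : t ≤ 1 / (16 * B)) (hB : 0 < B) (z : ℝ) :
    Real.exp (2 * B * (Real.sqrt (2 * t) * z) ^ 2) ≤ Real.exp (z ^ 2 / 4) := by
  rw [mul_pow, Real.sq_sqrt (by linarith), Real.exp_le_exp]
  rw [le_div_iff₀ (by positivity)] at htB
  nlinarith [sq_nonneg z]

theorem integrable_shift_of_exp_growth {ψ : ℝ → ℝ} (hm : Measurable ψ) {M B : ℝ} (hB : 0 < B)
    (hψ : ∀ y, |ψ y| ≤ M * Real.exp (B * y ^ 2)) {t : ℝ} (ht : 0 ≤ t) (htB : t ≤ 1 / (16 * B))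
    (x : ℝ) : Integrable (fun z => ψ (x + Real.sqrt (2 * t) * z)) (gaussianReal 0 1) := by
  have hM : 0 ≤ M := by simpa using (abs_nonneg _).trans (hψ 0)
  refine integrable_gaussianReal_of_le (hm.comp (by fun_prop))
    (C := M * Real.exp (2 * B * x ^ 2)) fun z => (exp_growth_shift hB hψ x _).trans ?_
  refine mul_le_mul_of_nonneg_left ((exp_sqrt_le ht htB hB z).trans ?_) (by positivity)
  have : 0 ≤ z ^ 2 * Real.exp (z ^ 2 / 4) := by positivity
  linarith

/-- The remainder of the second order Taylor expansion, divided by `h²`. -/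
def taylorRem (ψ : ℝ → ℝ) (d1 d2 x h : ℝ) : ℝ :=
  (ψ (x + h) - ψ x - d1 * h - d2 / 2 * h ^ 2) / h ^ 2

theorem taylorRem_spec (ψ : ℝ → ℝ) (d1 d2 x h : ℝ) :
    ψ (x + h) = ψ x + d1 * h + d2 / 2 * h ^ 2 + h ^ 2 * taylorRem ψ d1 d2 x h := by
  rcases eq_or_ne h 0 with rfl | hh
  · simp
  · rw [taylorRem]; field_simp; ring

/-- One use of l'Hôpital's rule reduces this to the difference quotient of `ψ'`, so `ψ'` need only
be differentiable at `x`. -/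
theorem tendsto_taylorRem {ψ ψ' : ℝ → ℝ} {d2 x : ℝ} (h1 : ∀ᶠ y in 𝓝 x, HasDerivAt ψ (ψ' y) y)
    (h2 : HasDerivAt ψ' d2 x) : Tendsto (taylorRem ψ (ψ' x) d2 x) (𝓝 0) (𝓝 0) := by
  have key : Tendsto (taylorRem ψ (ψ' x) d2 x) (𝓝[≠] 0) (𝓝 0) := by
    have hshift : Tendsto (fun h : ℝ => x + h) (𝓝 0) (𝓝 x) :=
      Continuous.tendsto' (by fun_prop) 0 x (by simp)
    have hev : ∀ᶠ h in 𝓝 (0 : ℝ), HasDerivAt ψ (ψ' (x + h)) (x + h) := hshift.eventually h1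
    refine HasDerivAt.lhopital_zero_nhdsNE
      (f := fun h => ψ (x + h) - ψ x - ψ' x * h - d2 / 2 * h ^ 2) (g := fun h => h ^ 2)
      (f' := fun h => ψ' (x + h) - ψ' x - d2 * h) (g' := fun h => 2 * h) ?_ ?_ ?_ ?_ ?_ ?_
    · filter_upwards [hev.filter_mono nhdsWithin_le_nhds] with h hh
      have := (((hh.comp_const_add x h).sub_const (ψ x)).sub
        ((hasDerivAt_id h).const_mul (ψ' x))).sub (((hasDerivAt_id h).pow 2).const_mul (d2 / 2))
      refine this.congr_deriv ?_
      simp; ring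
    · exact Eventually.of_forall fun h => by simpa using hasDerivAt_pow 2 h
    · filter_upwards [self_mem_nhdsWithin] with h hh
      simpa using hh
    · have hc : ContinuousAt (fun h => ψ (x + h) - ψ x - ψ' x * h - d2 / 2 * h ^ 2) 0 := by
        have : ContinuousAt (fun h => ψ (x + h)) 0 :=
          (h1.self_of_nhds.continuousAt.comp_of_eq (f := fun h : ℝ => x + h) (by fun_prop)
            (by simp))
        exact ((this.sub continuousAt_const).sub (by fun_prop)).sub (by fun_prop)
      have := hc.tendsto.mono_left (nhdsWithin_le_nhds (s := {0}ᶜ))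
      simpa using this
    · have : Tendsto (fun h : ℝ => h ^ 2) (𝓝 0) (𝓝 0) :=
        Continuous.tendsto' (by fun_prop) 0 0 (by simp)
      exact this.mono_left nhdsWithin_le_nhds
    · have hsl := hasDerivAt_iff_tendsto_slope_zero.1 h2
      have : Tendsto (fun h => (h⁻¹ • (ψ' (x + h) - ψ' x) - d2) / 2) (𝓝[≠] 0) (𝓝 ((d2 - d2) / 2)) :=
        (hsl.sub_const d2).div_const 2
      rw [sub_self, zero_div] at this
      refine this.congr' ?_
      filter_upwards [self_mem_nhdsWithin] with h hh
      have : h ≠ 0 := hh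
      simp only [smul_eq_mul]; field_simp
  -- Division by zero yields the value that makes the remainder continuous at `0`, so the limit need
  -- not avoid `h = 0`.
  have hzero : taylorRem ψ (ψ' x) d2 x 0 = 0 := by simp [taylorRem]
  have hc : ContinuousAt (taylorRem ψ (ψ' x) d2 x) 0 :=
    continuousWithinAt_compl_self.1 (by rwa [ContinuousWithinAt, hzero])
  rwa [ContinuousAt, hzero] at hc

/-- Near `0` the limit bounds the remainder. For `|h| ≥ δ` each term of the numerator is bounded
directly, and division by `h²` costs at most powers of `1 / δ`. -/
theorem exists_taylorRem_bound {ψ : ℝ → ℝ} {d1 d2 x M B : ℝ} (hB : 0 < B)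
    (hψ : ∀ y, |ψ y| ≤ M * Real.exp (B * y ^ 2))
    (h0 : Tendsto (taylorRem ψ d1 d2 x) (𝓝 0) (𝓝 0)) :
    ∃ C, 0 ≤ C ∧ ∀ h, |taylorRem ψ d1 d2 x h| ≤ C * Real.exp (2 * B * h ^ 2) := by
  have hM : 0 ≤ M := by simpa using (abs_nonneg _).trans (hψ 0)
  obtain ⟨δ, hδ, hnear⟩ := Metric.eventually_nhds_iff.1 (Metric.tendsto_nhds.1 h0 1 one_pos)
  refine ⟨1 + (M * Real.exp (2 * B * x ^ 2) + |ψ x|) / δ ^ 2 + |d1| / δ + |d2| / 2, by positivity,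
    fun h => ?_⟩
  have he : 1 ≤ Real.exp (2 * B * h ^ 2) := Real.one_le_exp (by positivity)
  set Eh := Real.exp (2 * B * h ^ 2) with hEh
  set M' := M * Real.exp (2 * B * x ^ 2) with hM'
  have hM'0 : 0 ≤ M' := by positivity
  rcases lt_or_ge |h| δ with hh | hh
  · have h1 : |taylorRem ψ d1 d2 x h| < 1 := by
      simpa using hnear (y := h) (by simpa using hh)
    have h2 : 0 ≤ (M' + |ψ x|) / δ ^ 2 + |d1| / δ + |d2| / 2 := by positivity
    nlinarith
  · have hhp : 0 < |h| := hδ.trans_le hh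
    have hsq : 0 < h ^ 2 := by rw [← sq_abs]; positivity
    have hδh : δ ^ 2 ≤ h ^ 2 := by rw [← sq_abs h]; gcongr
    have t1 : |ψ (x + h) - ψ x| ≤ (M' + |ψ x|) * Eh := by
      have e1 := exp_growth_shift hB hψ x h
      have e2 := abs_sub (ψ (x + h)) (ψ x)
      have e3 : |ψ x| ≤ |ψ x| * Eh := le_mul_of_one_le_right (abs_nonneg _) he
      rw [add_mul]; linarith
    have hnum : |ψ (x + h) - ψ x - d1 * h - d2 / 2 * h ^ 2| ≤
        (M' + |ψ x|) * Eh + |d1| * |h| + |d2| / 2 * h ^ 2 := by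
      have e1 := abs_sub (ψ (x + h) - ψ x - d1 * h) (d2 / 2 * h ^ 2)
      have e2 := abs_sub (ψ (x + h) - ψ x) (d1 * h)
      rw [abs_mul] at e2
      rw [abs_mul, abs_div, abs_two, abs_of_pos hsq] at e1
      linarith
    rw [taylorRem, abs_div, abs_of_pos hsq, div_le_iff₀ hsq]
    refine hnum.trans ?_
    have a1 : (M' + |ψ x|) * Eh ≤ (M' + |ψ x|) / δ ^ 2 * Eh * h ^ 2 := by
      have : (M' + |ψ x|) * Eh = (M' + |ψ x|) / δ ^ 2 * Eh * δ ^ 2 := by field_simp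
      rw [this]; gcongr
    have a2 : |d1| * |h| ≤ |d1| / δ * Eh * h ^ 2 := by
      have e1 : |d1| * |h| = |d1| / δ * 1 * (δ * |h|) := by field_simp
      have e2 : δ * |h| ≤ h ^ 2 := by rw [← sq_abs h, sq]; gcongr
      rw [e1]; gcongr
    have a3 : |d2| / 2 * h ^ 2 ≤ |d2| / 2 * Eh * h ^ 2 := by
      have : |d2| / 2 * h ^ 2 = |d2| / 2 * 1 * h ^ 2 := by ring
      rw [this]; gcongr
    have a4 : 0 ≤ Eh * h ^ 2 := by positivity
    calc _ ≤ (M' + |ψ x|) / δ ^ 2 * Eh * h ^ 2 + |d1| / δ * Eh * h ^ 2 + |d2| / 2 * Eh * h ^ 2 := by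
          linarith
      _ ≤ _ := by linarith

theorem integral_sq_gaussianReal : ∫ z, z ^ 2 ∂(gaussianReal 0 1) = 1 := by
  have h := variance_id_gaussianReal (μ := 0) (v := 1)
  rw [variance_eq_integral aemeasurable_id] at h
  simpa using h

/-- The heat flow satisfies the heat equation at time zero at points of twice
differentiability. -/
theorem hasDerivWithinAt_lineFlow_zero {ψ ψ' : ℝ → ℝ} (hm : Measurable ψ) {M B : ℝ} (hB : 0 < B)
    (hψ : ∀ y, |ψ y| ≤ M * Real.exp (B * y ^ 2)) {d2 x : ℝ}
    (h1 : ∀ᶠ y in 𝓝 x, HasDerivAt ψ (ψ' y) y) (h2 : HasDerivAt ψ' d2 x) :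
    HasDerivWithinAt (fun t => lineFlow ψ t x) d2 (Ioi 0) 0 := by
  set ε := taylorRem ψ (ψ' x) d2 x with hε
  have hε0 : Tendsto ε (𝓝 0) (𝓝 0) := tendsto_taylorRem h1 h2
  obtain ⟨C, hC0, hC⟩ := exists_taylorRem_bound hB hψ hε0
  have hεm : Measurable ε := by
    simp only [hε]; unfold taylorRem
    have : Measurable fun h => ψ (x + h) := hm.comp (by fun_prop)
    fun_prop
  have hbd : ∀ t, 0 ≤ t → t ≤ 1 / (16 * B) → ∀ z : ℝ, |z ^ 2 * ε (Real.sqrt (2 * t) * z)| ≤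
      C * (z ^ 2 * Real.exp (z ^ 2 / 4) + Real.exp (z ^ 2 / 4)) := by
    intro t ht htB z
    rw [abs_mul, abs_of_nonneg (sq_nonneg z)]
    have e1 := (hC (Real.sqrt (2 * t) * z)).trans
      (mul_le_mul_of_nonneg_left (exp_sqrt_le ht htB hB z) hC0)
    have e2 : 0 ≤ C * Real.exp (z ^ 2 / 4) := by positivity
    have e3 := mul_le_mul_of_nonneg_left e1 (sq_nonneg z)
    rw [mul_add]
    calc _ ≤ _ := e3
      _ = C * (z ^ 2 * Real.exp (z ^ 2 / 4)) := by ring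
      _ ≤ _ := by linarith
  have hint : ∀ t, 0 ≤ t → t ≤ 1 / (16 * B) →
      Integrable (fun z => z ^ 2 * ε (Real.sqrt (2 * t) * z)) (gaussianReal 0 1) := fun t ht htB =>
    integrable_gaussianReal_of_le (by fun_prop) (hbd t ht htB)
  have hI1 : Integrable (fun z : ℝ => z) (gaussianReal 0 1) :=
    integrable_gaussianReal_of_le (C := 1) (by fun_prop) fun z => by
      have h1 : 1 ≤ Real.exp (z ^ 2 / 4) := Real.one_le_exp (by positivity)
      have h2 : |z| ≤ z ^ 2 + 1 := by rw [← sq_abs]; nlinarith [sq_nonneg (|z| - 1)]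
      nlinarith [sq_nonneg z]
  have hI2 : Integrable (fun z : ℝ => z ^ 2) (gaussianReal 0 1) :=
    integrable_gaussianReal_of_le (C := 1) (by fun_prop) fun z => by
      have h1 : 1 ≤ Real.exp (z ^ 2 / 4) := Real.one_le_exp (by positivity)
      rw [abs_of_nonneg (sq_nonneg z)]
      nlinarith [sq_nonneg z]
  -- The first moment vanishes, and the second moment turns `(d2 / 2) · 2t` into `t d2`. The rest is
  -- `t` times a quantity tending to `0`.
  have hexp : ∀ t, 0 ≤ t → t ≤ 1 / (16 * B) → lineFlow ψ t x =
      ψ x + t * d2 + 2 * t * ∫ z, z ^ 2 * ε (Real.sqrt (2 * t) * z) ∂(gaussianReal 0 1) := by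
    intro t ht htB
    have e : ∀ z, ψ (x + Real.sqrt (2 * t) * z) = (ψ x + (ψ' x * Real.sqrt (2 * t)) * z) +
        (t * d2) * z ^ 2 + 2 * t * (z ^ 2 * ε (Real.sqrt (2 * t) * z)) := by
      intro z
      have hsq : Real.sqrt (2 * t) ^ 2 = 2 * t := Real.sq_sqrt (by linarith)
      rw [taylorRem_spec ψ (ψ' x) d2 x, mul_pow, hsq, hε]
      ring
    have i0 : Integrable (fun _ : ℝ => ψ x) (gaussianReal 0 1) := integrable_const _
    rw [lineFlow_eq_integral_sqrt hm ht]
    simp only [e]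
    have i1 : Integrable (fun z => ψ x + (ψ' x * Real.sqrt (2 * t)) * z) (gaussianReal 0 1) :=
      i0.add (hI1.const_mul _)
    have i2 : Integrable (fun z => (ψ x + (ψ' x * Real.sqrt (2 * t)) * z) + (t * d2) * z ^ 2)
        (gaussianReal 0 1) := i1.add (hI2.const_mul _)
    rw [integral_add i2 ((hint t ht htB).const_mul _), integral_add i1 (hI2.const_mul _),
      integral_add i0 (hI1.const_mul _), integral_const_mul, integral_const_mul,
      integral_const_mul, integral_sq_gaussianReal, integral_id_gaussianReal]
    simp
  rw [hasDerivWithinAt_iff_tendsto_slope' (by simp)]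
  have hsmall : ∀ᶠ t in 𝓝[>] (0 : ℝ), t ≤ 1 / (16 * B) := by
    filter_upwards [Ioc_mem_nhdsGT (show (0 : ℝ) < 1 / (16 * B) by positivity)] with t ht
      using ht.2
  have hlim : Tendsto (fun t => ∫ z, z ^ 2 * ε (Real.sqrt (2 * t) * z) ∂(gaussianReal 0 1))
      (𝓝[>] 0) (𝓝 (∫ z : ℝ, (0 : ℝ) ∂(gaussianReal 0 1))) := by
    refine tendsto_integral_filter_of_dominated_convergence
      (fun z => C * (z ^ 2 * Real.exp (z ^ 2 / 4) + Real.exp (z ^ 2 / 4))) ?_ ?_ ?_ ?_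
    · exact Eventually.of_forall fun t => Measurable.aestronglyMeasurable (by fun_prop)
    · filter_upwards [hsmall, self_mem_nhdsWithin] with t ht ht0
      exact ae_of_all _ (hbd t (le_of_lt ht0) ht)
    · exact integrable_gaussianReal_of_le (C := C) (by fun_prop) fun z =>
        (abs_of_nonneg (by positivity)).le
    · refine ae_of_all _ fun z => ?_
      have h3 : Tendsto (fun t : ℝ => Real.sqrt (2 * t) * z) (𝓝[>] 0) (𝓝 0) :=
        (Continuous.tendsto' (by fun_prop) 0 0 (by simp)).mono_left nhdsWithin_le_nhds
      simpa using (hε0.comp h3).const_mul (z ^ 2)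
  simp only [integral_zero] at hlim
  have hlim2 := (hlim.const_mul 2).const_add d2
  rw [mul_zero, add_zero] at hlim2
  refine hlim2.congr' ?_
  filter_upwards [hsmall, self_mem_nhdsWithin] with t ht ht0
  have ht0' : (0 : ℝ) < t := ht0
  rw [slope_def_field, hexp t ht0'.le ht, lineFlow_zero hm]
  generalize ∫ z, z ^ 2 * ε (Real.sqrt (2 * t) * z) ∂(gaussianReal 0 1) = I
  rw [sub_zero]
  field_simp
  ring

/-! ### Necessity: the test functions `f_F(max(x₁, c))` -/

/-- The profile `s ↦ f_F(max(s, c))`. -/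
def rampProfile (F : ℝ → ℝ) (c s : ℝ) : ℝ := inverse F (max s c)

section Ramp

variable {F : ℝ → ℝ}

theorem Admissible.max_mem_imageSet (hF : Admissible F) (htop : Tendsto F atTop atTop)
    (a s : ℝ) : max s (F a) ∈ imageSet F :=
  hF.mem_imageSet_of_le htop (le_max_right _ _)

theorem Admissible.apply_rampProfile (hF : Admissible F) (htop : Tendsto F atTop atTop)
    (a s : ℝ) : F (rampProfile F (F a) s) = max s (F a) :=
  apply_inverse (hF.max_mem_imageSet htop a s)

theorem Admissible.le_rampProfile (hF : Admissible F) (htop : Tendsto F atTop atTop)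
    (a s : ℝ) : a ≤ rampProfile F (F a) s := by
  rw [← hF.strictMono.le_iff_le, hF.apply_rampProfile htop]
  exact le_max_right _ _

theorem Admissible.continuous_rampProfile (hF : Admissible F) (htop : Tendsto F atTop atTop)
    (a : ℝ) : Continuous (rampProfile F (F a)) :=
  continuous_iff_continuousAt.2 fun s =>
    (hF.continuousAt_inverse (hF.max_mem_imageSet htop a s)).comp
      (f := fun s => max s (F a)) (by fun_prop)

/-- Since `f_F` is increasing, the part of the integral over `[z, z + 1]` is at least `e^{-A(2z² +
2)} f_F(z)`. Integrability thus becomes pointwise Gaussian growth. -/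
theorem Admissible.inverse_le_exp (hF : Admissible F) (htop : Tendsto F atTop atTop) {A : ℝ}
    (hA : 0 < A) (hI : gaussIntegral F A < ⊤) {z : ℝ} (hz : F 1 ≤ z) :
    inverse F z ≤ (gaussIntegral F A).toReal * Real.exp (2 * A * z ^ 2 + 2 * A) := by
  have hzm := hF.mem_imageSet_of_le htop hz
  have hf1 : 1 ≤ inverse F z := by
    have := hF.inverse_le_inverse ⟨1, rfl⟩ hzm hz
    rwa [hF.inverse_apply] at this
  set κ := Real.exp (-(2 * A * z ^ 2 + 2 * A)) with hκ
  have hlow : ENNReal.ofReal (κ * inverse F z) ≤ gaussIntegral F A := by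
    calc ENNReal.ofReal (κ * inverse F z)
        = ∫⁻ _ in Icc z (z + 1), ENNReal.ofReal (κ * inverse F z) := by
          rw [setLIntegral_const, Real.volume_Icc]; simp
      _ ≤ ∫⁻ y in Icc z (z + 1), ENNReal.ofReal (Real.exp (-A * y ^ 2) * inverse F y) := by
          refine setLIntegral_mono' measurableSet_Icc fun y hy => ENNReal.ofReal_le_ofReal ?_
          have h1 := hF.inverse_le_inverse hzm (hF.mem_imageSet_of_le htop (hz.trans hy.1)) hy.1
          refine mul_le_mul (Real.exp_le_exp.2 ?_) h1 (by linarith) (Real.exp_pos _).le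
          have h2 : y ^ 2 ≤ 2 * z ^ 2 + 2 := by
            obtain ⟨u, rfl⟩ : ∃ u, y = z + u := ⟨y - z, by ring⟩
            have h3 : 0 ≤ u := by linarith [hy.1]
            have h4 : u ≤ 1 := by linarith [hy.2]
            nlinarith [sq_nonneg (z - u)]
          nlinarith
      _ ≤ gaussIntegral F A :=
          lintegral_mono_set fun y hy => hz.trans hy.1
  have h5 : κ * inverse F z ≤ (gaussIntegral F A).toReal :=
    (ENNReal.ofReal_le_iff_le_toReal hI.ne).1 hlow
  have h6 : κ * Real.exp (2 * A * z ^ 2 + 2 * A) = 1 := by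
    rw [hκ, ← Real.exp_add]; simp
  calc inverse F z = κ * inverse F z * Real.exp (2 * A * z ^ 2 + 2 * A) := by
        rw [mul_right_comm, h6, one_mul]
    _ ≤ _ := by gcongr

theorem Admissible.exists_rampProfile_bound (hF : Admissible F) (htop : Tendsto F atTop atTop)
    {A : ℝ} (hA : 0 < A) (hI : gaussIntegral F A < ⊤) (a : ℝ) :
    ∃ M, ∀ y, |rampProfile F (F a) y| ≤ M * Real.exp (2 * A * y ^ 2) := by
  set I := (gaussIntegral F A).toReal with hIdef
  have hI0 : 0 ≤ I := ENNReal.toReal_nonneg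
  refine ⟨|a| + 1 + I * Real.exp (2 * A * (F a) ^ 2 + 2 * A), fun y => ?_⟩
  have he : 1 ≤ Real.exp (2 * A * y ^ 2) := Real.one_le_exp (by positivity)
  have hlow := hF.le_rampProfile htop a y
  have hup : rampProfile F (F a) y ≤
      1 + I * Real.exp (2 * A * (F a) ^ 2 + 2 * A) * Real.exp (2 * A * y ^ 2) := by
    have hpos : 0 ≤ I * Real.exp (2 * A * (F a) ^ 2 + 2 * A) * Real.exp (2 * A * y ^ 2) := by
      positivity
    rcases le_total (F 1) (max y (F a)) with h | h
    · have h1 := hF.inverse_le_exp htop hA hI h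
      have h2 : max y (F a) ^ 2 ≤ y ^ 2 + F a ^ 2 := by
        rcases max_choice y (F a) with e | e <;> rw [e] <;> nlinarith [sq_nonneg y, sq_nonneg (F a)]
      have h3 : Real.exp (2 * A * max y (F a) ^ 2 + 2 * A) ≤
          Real.exp (2 * A * (F a) ^ 2 + 2 * A) * Real.exp (2 * A * y ^ 2) := by
        rw [← Real.exp_add, Real.exp_le_exp]; nlinarith
      have h4 := mul_le_mul_of_nonneg_left h3 hI0
      rw [rampProfile]
      linarith
    · have h1 : rampProfile F (F a) y ≤ 1 := by
        rw [← hF.strictMono.le_iff_le, hF.apply_rampProfile htop]; exact h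
      linarith
  have h0 : |a| ≤ |a| * Real.exp (2 * A * y ^ 2) := le_mul_of_one_le_right (abs_nonneg _) he
  have hpos : 0 ≤ I * Real.exp (2 * A * (F a) ^ 2 + 2 * A) * Real.exp (2 * A * y ^ 2) := by
    positivity
  rw [abs_le, add_mul, add_mul, one_mul]
  constructor
  · linarith [neg_abs_le a]
  · linarith [abs_nonneg a]

end Ramp

theorem integrable_lineFlow_of_exp_growth {ψ : ℝ → ℝ} (hm : Measurable ψ) {M B : ℝ} (hB : 0 < B)
    (hψ : ∀ y, |ψ y| ≤ M * Real.exp (B * y ^ 2)) {t : ℝ} (ht : 0 ≤ t) (htB : t ≤ 1 / (16 * B))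
    (x : ℝ) : Integrable (fun z => ψ (x + z)) (heatMeasure t) := by
  rw [heatMeasure_eq_map ht, integrable_map_measure
    (Measurable.aestronglyMeasurable (by fun_prop)) (by fun_prop)]
  exact integrable_shift_of_exp_growth hm hB hψ ht htB x

theorem integral_heatMeasurePi_eval {n : ℕ} (i : Fin n) {ψ : ℝ → ℝ} (hm : Measurable ψ) (t x : ℝ) :
    ∫ z, ψ (x + z i) ∂(heatMeasurePi n t) = lineFlow ψ t x := by
  have hp := measurePreserving_eval (fun _ : Fin n => heatMeasure t) i
  rw [lineFlow, ← hp.map_eq, integral_map hp.measurable.aemeasurable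
    (Measurable.aestronglyMeasurable (by fun_prop))]
  rfl

/-- If `F`-convexity is preserved, then the one-dimensional flow of the ramp profile remains
`F`-convex for short times. -/
theorem Preserved.convexOn_lineFlow_rampProfile {n : ℕ} (hn : 1 ≤ n) {F : ℝ → ℝ}
    (hF : Admissible F) (htop : Tendsto F atTop atTop) {A : ℝ} (hA : 0 < A)
    (hI : gaussIntegral F A < ⊤) (hP : Preserved n F) (a : ℝ) {t : ℝ} (ht : 0 < t)
    (htA : t < 1 / (16 * (2 * A))) :
    ConvexOn ℝ univ fun s => F (lineFlow (rampProfile F (F a)) t s) := by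
  set ψ := rampProfile F (F a) with hψ
  have hm : Measurable ψ := (hF.continuous_rampProfile htop a).measurable
  obtain ⟨M, hM⟩ := hF.exists_rampProfile_bound htop hA hI a
  let i : Fin n := ⟨0, hn⟩
  -- A datum depending on one coordinate flows by the one-dimensional heat flow in that coordinate.
  set φ : E n → ℝ := fun x => ψ (x i) with hφ
  have hint : ∀ s : ℝ, 0 < s → s ≤ 1 / (16 * (2 * A)) → ∀ x : E n,
      Integrable (fun y => gaussKernel n (x - y) s * φ y) := by
    intro s hs hsA x
    rw [integrable_gaussKernel_iff hs]
    have hp := measurePreserving_eval (fun _ : Fin n => heatMeasure s) i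
    have := integrable_lineFlow_of_exp_growth hm (by positivity) hM hs.le hsA (x i)
    exact hp.integrable_comp_of_integrable this
  have hT : ENNReal.ofReal (1 / (16 * (2 * A))) ≤ existenceTime φ := by
    refine le_sSup fun s hs hsT x => hint s hs ?_ x
    exact ((ENNReal.ofReal_lt_ofReal_iff (by positivity)).1 hsT).le
  have htT : ENNReal.ofReal t < existenceTime φ :=
    ((ENNReal.ofReal_lt_ofReal_iff (by positivity)).2 htA).trans_le hT
  have hflow : ∀ x : E n, heatFlow φ t x = lineFlow ψ t (x i) := fun x => by
    rw [heatFlow_eq_integral ht, ← integral_heatMeasurePi_eval i hm]; rfl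
  have hconv := hP φ ⟨a, by rintro _ ⟨x, rfl⟩; exact hF.le_rampProfile htop a _⟩
    (by
      refine ⟨convex_univ, fun x _ y _ l m hl hm hlm => ?_⟩
      simp only [hφ, hψ, hF.apply_rampProfile htop, smul_eq_mul]
      have e : (l • x + m • y) i = l * x i + m * y i := rfl
      rw [e]
      have hb : F a = l * F a + m * F a := by rw [← add_mul, hlm, one_mul]
      refine max_le ?_ ?_
      · gcongr <;> exact le_max_left _ _
      · calc F a = l * F a + m * F a := hb
          _ ≤ _ := by gcongr <;> exact le_max_right _ _)
    (pos_of_gt htT) t ht htT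
  refine ⟨convex_univ, fun s0 _ s1 _ l m hl hm hlm => ?_⟩
  have := hconv.2 (mem_univ (EuclideanSpace.single i s0)) (mem_univ (EuclideanSpace.single i s1))
    hl hm hlm
  simpa [hflow] using this

/-- Near `F r` the profile is `f_F`, so by the heat equation at time zero the limit is `F'(r)
f_F''(F r) = -F''(r) / F'(r)²`. -/
theorem Admissible.tendsto_slope_rampProfile {F : ℝ → ℝ} (hF : Admissible F)
    (h2 : ContDiff ℝ 2 F) (htop : Tendsto F atTop atTop) {A : ℝ} (hA : 0 < A)
    (hI : gaussIntegral F A < ⊤) {a r : ℝ} (har : a < r) (hr : 0 < deriv F r) :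
    Tendsto (fun t => (F (lineFlow (rampProfile F (F a)) t (F r)) - F r) / t) (𝓝[>] 0)
      (𝓝 (gradCoeff F r)) := by
  have hm : Measurable (rampProfile F (F a)) := (hF.continuous_rampProfile htop a).measurable
  obtain ⟨M, hM⟩ := hF.exists_rampProfile_bound htop hA hI a
  have hloc : ∀ᶠ z in 𝓝 (F r), F a < z := lt_mem_nhds (hF.strictMono har)
  have heq : ∀ᶠ z in 𝓝 (F r), rampProfile F (F a) =ᶠ[𝓝 z] inverse F := by
    filter_upwards [hloc] with z hz
    filter_upwards [lt_mem_nhds hz] with y hy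
    rw [rampProfile, max_eq_left hy.le]
  have hc : ContinuousAt (fun z => deriv F (inverse F z)) (F r) :=
    (h2.continuous_deriv one_le_two).continuousAt.comp (hF.continuousAt_inverse ⟨r, rfl⟩)
  have hp : ∀ᶠ z in 𝓝 (F r), 0 < deriv F (inverse F z) :=
    hc.eventually (lt_mem_nhds (by simpa only [hF.inverse_apply] using hr))
  have h1 : ∀ᶠ z in 𝓝 (F r), HasDerivAt (rampProfile F (F a)) (deriv F (inverse F z))⁻¹ z := by
    filter_upwards [heq, hp, hF.eventually_mem_imageSet r] with z hz hzp hzm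
    refine HasDerivAt.congr_of_eventuallyEq ?_ hz
    have := hF.hasDerivAt_inverse (h2.differentiable two_ne_zero _) hzp.ne'
    rwa [apply_inverse hzm] at this
  have hd : HasDerivAt (fun z => deriv F (inverse F z)) (deriv (deriv F) r * (deriv F r)⁻¹)
      (F r) := by
    refine HasDerivAt.comp (h₂ := deriv F) (F r) ?_
      (hF.hasDerivAt_inverse (h2.differentiable two_ne_zero _) hr.ne')
    rw [hF.inverse_apply]
    exact hasDerivAt_deriv_of_contDiff_two h2 r
  have hd2 := hd.fun_inv (by rw [hF.inverse_apply]; exact hr.ne')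
  have hflow := hasDerivWithinAt_lineFlow_zero hm (by positivity) hM h1 hd2
  have h0 : lineFlow (rampProfile F (F a)) 0 (F r) = r := by
    rw [lineFlow_zero hm, rampProfile, max_eq_left (hF.strictMono har).le, hF.inverse_apply]
  have hFd : HasDerivAt F (deriv F r) (lineFlow (rampProfile F (F a)) 0 (F r)) := by
    rw [h0]; exact (h2.differentiable two_ne_zero r).hasDerivAt
  have hcomp := hFd.comp_hasDerivWithinAt (0 : ℝ) hflow
  rw [hasDerivWithinAt_iff_tendsto_slope' (by simp)] at hcomp
  have e : deriv F r * (-(deriv (deriv F) r * (deriv F r)⁻¹) / deriv F (inverse F (F r)) ^ 2) =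
      gradCoeff F r := by
    rw [hF.inverse_apply, gradCoeff]; field_simp
  rw [e] at hcomp
  refine hcomp.congr fun t => ?_
  rw [slope_def_field, sub_zero, Function.comp, Function.comp, h0]

/-! ### Necessity: convexity of `g_F` and positivity of `F'`. -/

/-- At time zero the convexity inequality for `F(u)` is an equality, because `F(u)` is the identity
beyond `F a`. Subtracting it, dividing by `t` and letting `t → 0` gives the inequality for `g_F`.
The set `S` is free so that half-open intervals avoiding a zero of `F'` can be treated first. -/
theorem Preserved.convexOn_logDerivInverse {n : ℕ} (hn : 1 ≤ n) {F : ℝ → ℝ}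
    (hF : Admissible F) (h2 : ContDiff ℝ 2 F) (htop : Tendsto F atTop atTop) {A : ℝ} (hA : 0 < A)
    (hI : gaussIntegral F A < ⊤) (hP : Preserved n F) {S : Set ℝ} (hS : Convex ℝ S)
    (hSJ : S ⊆ imageSet F) (hpos : ∀ r, F r ∈ S → 0 < deriv F r) :
    ConvexOn ℝ S (logDerivInverse F) := by
  refine ⟨hS, fun z0 hz0 z1 hz1 l m hl hm hlm => ?_⟩
  have hzm := hS hz0 hz1 hl hm hlm
  obtain ⟨r0, rfl⟩ := hSJ hz0
  obtain ⟨r1, rfl⟩ := hSJ hz1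
  obtain ⟨rm, hrm⟩ := hSJ hzm
  rw [← hrm] at hzm ⊢
  obtain ⟨a, ham, ha0, ha1⟩ : ∃ a, a < rm ∧ a < r0 ∧ a < r1 := by
    obtain ⟨a, ha⟩ := exists_lt (min rm (min r0 r1))
    simp only [lt_min_iff] at ha
    exact ⟨a, ha.1, ha.2.1, ha.2.2⟩
  rw [hF.logDerivInverse_apply h2 (hpos _ hz0), hF.logDerivInverse_apply h2 (hpos _ hz1),
    hF.logDerivInverse_apply h2 (hpos _ hzm)]
  have tm := hF.tendsto_slope_rampProfile h2 htop hA hI ham (hpos _ hzm)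
  have t0 := hF.tendsto_slope_rampProfile h2 htop hA hI ha0 (hpos _ hz0)
  have t1 := hF.tendsto_slope_rampProfile h2 htop hA hI ha1 (hpos _ hz1)
  refine le_of_tendsto_of_tendsto tm ((t0.const_mul l).add (t1.const_mul m)) ?_
  filter_upwards [Ioo_mem_nhdsGT (show (0 : ℝ) < 1 / (16 * (2 * A)) by positivity)] with t ht
  have hc := (hP.convexOn_lineFlow_rampProfile hn hF htop hA hI a ht.1 ht.2).2
    (mem_univ (F r0)) (mem_univ (F r1)) hl hm hlm
  simp only [smul_eq_mul] at hc hrm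
  rw [← hrm] at hc
  rw [mul_div_assoc', mul_div_assoc', ← add_div]
  refine div_le_div_of_nonneg_right ?_ ht.1.le
  linarith

/-- If `F'(α) = 0` and `F' > 0` just to the right of `α`, then `g_F` is not convex there, because
`log f_F'` would be bounded near `F(α)`. -/
theorem Admissible.deriv_ne_zero_of_convexOn {F : ℝ → ℝ} (hF : Admissible F)
    (h2 : ContDiff ℝ 2 F) {α β : ℝ} (hαβ : α < β) (hpos : ∀ r ∈ Ioc α β, 0 < deriv F r)
    (hconv : ConvexOn ℝ (Ioc (F α) (F β)) (logDerivInverse F)) : deriv F α ≠ 0 := by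
  obtain ⟨γ, hαγ, hγβ⟩ := exists_between hαβ
  set g := logDerivInverse F with hg
  set σ := (g (F β) - g (F γ)) / (F β - F γ) with hσ
  have hmemβ : F β ∈ Ioc (F α) (F β) := ⟨hF.strictMono hαβ, le_rfl⟩
  have hFγ : F α < F γ := hF.strictMono hαγ
  set N := |g (F γ)| + |σ| * (F γ - F α) with hN
  have hN0 : 0 ≤ N := by
    have : 0 ≤ F γ - F α := by linarith
    positivity
  have hsub : Ioc (F α) (F γ) ⊆ F '' Ioc α β := by
    intro z hz
    obtain ⟨r, rfl⟩ := hF.mem_imageSet_of_mem_Icc ⟨hz.1.le, hz.2⟩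
    exact ⟨r, ⟨hF.strictMono.lt_iff_lt.1 hz.1,
      (hF.strictMono.le_iff_le.1 hz.2).trans hγβ.le⟩, rfl⟩
  -- To the left of `F γ` a convex function stays above the extension of its chord from `F γ` to `F
  -- β`.
  have hbelow : ∀ z ∈ Ioo (F α) (F γ), -N ≤ g z := by
    intro z hz
    have hs := hconv.slope_mono_adjacent ⟨hz.1, hz.2.le.trans (hF.strictMono hγβ).le⟩ hmemβ hz.2
      (hF.strictMono hγβ)
    rw [← hσ, div_le_iff₀ (by linarith [hz.2])] at hs
    have h1 : σ * (F γ - z) ≤ |σ| * (F γ - F α) := by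
      calc σ * (F γ - z) ≤ |σ| * (F γ - z) :=
            mul_le_mul_of_nonneg_right (le_abs_self _) (by linarith [hz.2])
        _ ≤ _ := mul_le_mul_of_nonneg_left (by linarith [hz.1]) (abs_nonneg _)
    have := neg_abs_le (g (F γ))
    linarith
  set H : ℝ → ℝ := fun z => Real.log (deriv (inverse F) z) with hH
  have hHd : ∀ z ∈ Ioc (F α) (F γ), HasDerivAt H (g z) z := by
    intro z hz
    obtain ⟨r, hr, rfl⟩ := hsub hz
    rw [hg, hF.logDerivInverse_apply h2 (hpos r hr)]
    exact hF.hasDerivAt_log_deriv_inverse h2 (hpos r hr)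
  -- A lower bound on `H' = g` bounds `H = -log F' ∘ f_F` above to the left of `F γ`. Hence `F'`
  -- stays away from `0` down to `α`.
  have hmv := (convex_Ioc (F α) (F γ)).mul_sub_le_image_sub_of_le_deriv (f := H) (C := -N)
    (fun z hz => (hHd z hz).continuousAt.continuousWithinAt)
    (fun z hz => (hHd z (interior_subset hz)).differentiableAt.differentiableWithinAt)
    (fun z hz => by
      rw [(hHd z (interior_subset hz)).deriv]
      rw [interior_Ioc] at hz
      exact hbelow z hz)
  have hHF : ∀ r ∈ Ioc α β, H (F r) = -Real.log (deriv F r) := by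
    intro r hr
    rw [hH]
    simp only
    rw [(hF.hasDerivAt_inverse (h2.differentiable two_ne_zero _) (hpos r hr).ne').deriv,
      Real.log_inv]
  set κ := Real.exp (-(H (F γ) + N * (F γ - F α))) with hκ
  have hlow : ∀ r ∈ Ioo α γ, κ ≤ deriv F r := by
    intro r hr
    have hrβ : r ∈ Ioc α β := ⟨hr.1, hr.2.le.trans hγβ.le⟩
    have h1 := hmv (F r) ⟨hF.strictMono hr.1, (hF.strictMono hr.2).le⟩ (F γ) ⟨hFγ, le_rfl⟩
      (hF.strictMono hr.2).le
    rw [hHF r hrβ] at h1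
    have h3 : N * (F γ - F r) ≤ N * (F γ - F α) := by
      gcongr
      exact (hF.strictMono hr.1).le
    rw [hκ, ← Real.le_log_iff_exp_le (hpos r hrβ)]
    linarith
  have hlim : κ ≤ deriv F α := by
    refine ge_of_tendsto (((h2.continuous_deriv one_le_two).tendsto α).mono_left
      (nhdsWithin_le_nhds (s := Ioi α))) ?_
    filter_upwards [Ioo_mem_nhdsGT hαγ] with r hr using hlow r hr
  exact ((Real.exp_pos _).trans_le hlim).ne'

theorem Preserved.deriv_pos {n : ℕ} (hn : 1 ≤ n) {F : ℝ → ℝ}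
    (hF : Admissible F) (h2 : ContDiff ℝ 2 F) (htop : Tendsto F atTop atTop) {A : ℝ} (hA : 0 < A)
    (hI : gaussIntegral F A < ⊤) (hP : Preserved n F) (r : ℝ) : 0 < deriv F r := by
  have hnn : ∀ r, 0 ≤ deriv F r := fun r => hF.strictMono.monotone.deriv_nonneg
  refine lt_of_le_of_ne (hnn r) fun h0 => ?_
  obtain ⟨β, hβ, hβd⟩ := exists_deriv_eq_slope F (lt_add_one r) hF.continuous.continuousOn
    (h2.differentiable two_ne_zero).differentiableOn
  have hβpos : 0 < deriv F β := by
    rw [hβd]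
    exact div_pos (sub_pos.2 (hF.strictMono (lt_add_one r))) (by linarith)
  have hcl : IsClosed {x | deriv F x = 0} :=
    isClosed_eq (h2.continuous_deriv one_le_two) continuous_const
  -- `α` is the last zero of `F'` in `[r, β]`, so `F' > 0` on `(α, β]`, where `g_F` is already known
  -- to be convex.
  obtain ⟨α, ⟨hαm, hα0⟩, hαmax⟩ := (isCompact_Icc.inter_right hcl).exists_isGreatest
    ⟨r, left_mem_Icc.2 hβ.1.le, h0.symm⟩
  have hαβ : α < β := lt_of_le_of_ne hαm.2 (by rintro rfl; exact hβpos.ne' hα0)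
  have hpos : ∀ x ∈ Ioc α β, 0 < deriv F x := fun x hx =>
    lt_of_le_of_ne (hnn x) fun h => not_lt.2 (hαmax ⟨⟨hαm.1.trans hx.1.le, hx.2⟩, h.symm⟩) hx.1
  refine hF.deriv_ne_zero_of_convexOn h2 hαβ hpos ?_ hα0
  refine hP.convexOn_logDerivInverse hn hF h2 htop hA hI (convex_Ioc _ _)
    (fun z hz => hF.mem_imageSet_of_mem_Icc ⟨hz.1.le, hz.2⟩) fun x hx => hpos x ?_
  exact ⟨hF.strictMono.lt_iff_lt.1 hx.1, hF.strictMono.le_iff_le.1 hx.2⟩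

theorem Admissible.convex_imageSet {F : ℝ → ℝ} (hF : Admissible F) : Convex ℝ (imageSet F) :=
  (isPreconnected_range hF.continuous).ordConnected.convex

end HeatFConvex

end

theorem theorem4p1 (n : ℕ) (hn : 1 ≤ n) (F : ℝ → ℝ) (hF : HeatFConvex.Admissible F) :
    ((∃ L : ℝ, Filter.Tendsto F Filter.atTop (nhds L)) →
      HeatFConvex.OnlyTriviallyPreserved n F) ∧
    (Filter.Tendsto F Filter.atTop Filter.atTop →
      (∀ A : ℝ, 0 < A → HeatFConvex.gaussIntegral F A = ⊤) →
      HeatFConvex.OnlyTriviallyPreserved n F) ∧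
    (ContDiff ℝ 2 F → Filter.Tendsto F Filter.atTop Filter.atTop →
      (∃ A : ℝ, 0 < A ∧ HeatFConvex.gaussIntegral F A < ⊤) →
      (HeatFConvex.Preserved n F ↔
        (∀ r : ℝ, 0 < deriv F r) ∧
          ConvexOn ℝ (HeatFConvex.imageSet F) (HeatFConvex.logDerivInverse F))) := by
  refine ⟨fun ⟨_, hL⟩ => HeatFConvex.onlyTriviallyPreserved_of_tendsto_nhds hF hL,
    fun htop hA => HeatFConvex.onlyTriviallyPreserved_of_gaussIntegral_eq_top hn hF htop hA, ?_⟩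
  rintro h2 htop ⟨A, hA, hI⟩
  refine ⟨fun hP => ?_, fun h => HeatFConvex.preserved_of_convexOn hF h2 htop h.1 h.2⟩
  have hpos := hP.deriv_pos hn hF h2 htop hA hI
  exact ⟨hpos, hP.convexOn_logDerivInverse hn hF h2 htop hA hI hF.convex_imageSet
    Set.Subset.rfl fun r _ => hpos r⟩
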